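/- Let $1\le r\le\omega$ and let $\mathcal G\rightrightarrows M$ be a Lie groupoid of class $C^r$ with source map $\alpha$, target map $\beta$ and inclusion of units $\iota_M:M\to\mathcal G$, $x\mapsto 1_x$ (the manifolds $\mathcal G$ and $M$ being finite-dimensional, Hausdorff, without boundary). A bisection is a $C^r$ map $\sigma:M\to\mathcal G$ with $\alpha\circ\sigma=\mathrm{id}_M$ such that $\beta\circ\sigma$ is a $C^r$ diffeomorphism of $M$; bisections form a group $\mathrm{Bis}^r(\mathcal G)$ under $(\sigma\star\tau)(x)=\sigma(\beta(\tau(x))).\tau(x)$, with unit $\iota_M$. The support of $\sigma$ is $\overline{\{x:\sigma(x)\ne 1_x\}}$ and the support of $\beta\circ\sigma$ is $\overline{\{x:\beta(\sigma(x))\neq x\}}$. Let $\Gamma\le \mathrm{Bis}^r(\mathcal G)$ be a subgroup, and let $I\Gamma$ be the set of all $C^r$ maps $\sigma:\mathbb R\times M\to\mathcal G$, $(t,x)\mapsto\sigma_t(x)$, with $\sigma_t\in\Gamma$ for all $t$ and $\sigma_0=\iota_M$. For $A\subseteq M$, $C^1$ closeness on $A$ is closeness of tangent maps in the compact-open topology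 over $A$ (for families $(\sigma_t)$: of the tangent maps $T\sigma_t$ in the space variable, also uniformly on compact sets of $t$). Assume: (L) If $r\le\infty$: for all relatively compact open $U,V\subseteq M$ with $\overline U\subseteq V$ there is a $C^1$-neighbourhood $\mathcal N$ of $\iota_M$ such that for every $\sigma\in I\Gamma$ with $\sigma_t\in\mathcal N$ for all $t$ there is $\tau\in I\Gamma$ with $\tau_t=\sigma_t$ on $U$ and $\operatorname{supp}(\tau_t)\subseteq V$ for all $t$. If $r=\omega$: for all such $U,V$ there is a $C^1$-neighbourhood $\mathcal N$ of $\iota_M$ such that for every $\sigma\in I\Gamma$ with $\sigma_t\in\mathcal N$ for all $t$ there are $\tau\in I\Gamma$ for which $(\tau_t)$ is arbitrarily $C^1$ close to $(\sigma_t)$ on $U$ and at the same time arbitrarily $C^1$ close to the constant family $\iota_M$ on $M\setminus V$. (Fiberwise transitivity) For every $x\in M$ there are $k=\dim\alpha^{-1}(x)$ isotopies $\sigma^1,\dots,\sigma^k\in I\Gamma$ such that the vectors $\frac{\partial\sigma^1_t(x)}{\partial t}\big|_{t=0},\dots,\frac{\partial\sigma^k_t(x)}{\partial t}\big|_{t=0}$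 are linearly independent. Let $\mathcal G_x^\circ$ be the connected component of $1_x$ in $\alpha^{-1}(x)$, let $\mathcal G^\circ=\bigcup_{x\in M}\mathcal G_x^\circ$, and let $L_x=\beta(\mathcal G_x^\circ)$ be the leaf through $x$. Then for every $\gamma\in\mathcal G^\circ$ there is $\sigma\in\Gamma$ with $\sigma(\alpha(\gamma))=\gamma$. Moreover, for every open neighbourhood $V$ of the leaf $L_{\alpha(\gamma)}$ in $M$: if $r\le\infty$, such a $\sigma\in\Gamma$ can be chosen with $\operatorname{supp}(\beta\circ\sigma)\subseteq V$; if $r=\omega$, such a $\sigma\in\Gamma$ can be chosen with $\beta\circ\sigma$ arbitrarily $C^1$ close to $\mathrm{id}_M$ on $M\setminus V$. -/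

import Mathlib

open scoped Manifold ContDiff Topology
open Set

noncomputable section

/-- A Lie groupoid `G ⇉ M` of class `C^r`. The arrow space `G` and the unit space `M` are manifolds
without boundary, modelled on the finite-dimensional spaces `E` and `F`. The product `mul g h`
(written `g.h`) is meaningful only for composable pairs, i.e. when `src g = tgt h`; its values on the
other pairs are irrelevant. Since `src` is a submersion, the set of composable pairs is an embedded
submanifold of `G × G`, and `contMDiffOn_mul` says that the product is of class `C^r` on it. -/
structure LieGroupoid (r : WithTop ℕ∞) (E F G M : Type*)
    [NormedAddCommGroup E] [NormedSpace ℝ E] [NormedAddCommGroup F] [NormedSpace ℝ F]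
    [TopologicalSpace G] [ChartedSpace E G] [TopologicalSpace M] [ChartedSpace F M] where
  /-- the source map `α` -/
  src : G → M
  /-- the target map `β` -/
  tgt : G → M
  /-- the inclusion `ι_M : M → G` of the units -/
  one : M → G
  /-- inversion -/
  inv : G → G
  /-- the partial product -/
  mul : G → G → G
  src_one : ∀ x, src (one x) = x
  tgt_one : ∀ x, tgt (one x) = x
  src_inv : ∀ g, src (inv g) = tgt g
  tgt_inv : ∀ g, tgt (inv g) = src g
  src_mul : ∀ g h, src g = tgt h → src (mul g h) = src h
  tgt_mul : ∀ g h, src g = tgt h → tgt (mul g h) = tgt g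
  mul_assoc : ∀ g h k, src g = tgt h → src h = tgt k → mul (mul g h) k = mul g (mul h k)
  one_mul : ∀ g, mul (one (tgt g)) g = g
  mul_one : ∀ g, mul g (one (src g)) = g
  inv_mul : ∀ g, mul (inv g) g = one (src g)
  mul_inv : ∀ g, mul g (inv g) = one (tgt g)
  isSubmersion_src : Manifold.IsSubmersion 𝓘(ℝ, E) 𝓘(ℝ, F) r src
  isSubmersion_tgt : Manifold.IsSubmersion 𝓘(ℝ, E) 𝓘(ℝ, F) r tgt
  contMDiff_one : ContMDiff 𝓘(ℝ, F) 𝓘(ℝ, E) r one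
  contMDiff_inv : ContMDiff 𝓘(ℝ, E) 𝓘(ℝ, E) r inv
  contMDiffOn_mul : ContMDiffOn (𝓘(ℝ, E).prod 𝓘(ℝ, E)) 𝓘(ℝ, E) r
    (fun p : G × G => mul p.1 p.2) {p | src p.1 = tgt p.2}

/-! ### The `C¹` compact-open topology -/

/-- The topology of compact-open convergence on the subset `A`: the subbasic open sets are
`{f | f(K) ⊆ O}` with `K ⊆ A` compact and `O` open. -/
abbrev compactOpenOn {X Y : Type*} [TopologicalSpace X] [TopologicalSpace Y] (A : Set X) :
    TopologicalSpace (X → Y) :=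
  TopologicalSpace.generateFrom
    {S | ∃ K : Set X, K ⊆ A ∧ IsCompact K ∧ ∃ O : Set Y, IsOpen O ∧ S = {f | MapsTo f K O}}

section C1

variable {F E : Type*} [NormedAddCommGroup F] [NormedSpace ℝ F]
  [NormedAddCommGroup E] [NormedSpace ℝ E]
  {M N : Type*} [TopologicalSpace M] [ChartedSpace F M] [IsManifold 𝓘(ℝ, F) 1 M]
  [TopologicalSpace N] [ChartedSpace E N] [IsManifold 𝓘(ℝ, E) 1 N]

variable (F E) in
/-- The `C¹` compact-open topology on the subset `A ⊆ M`, for maps `M → N`: two maps are close if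
their tangent maps `TM → TN` are close, in the compact-open sense, over the points of `A`.
(It is only used at, and for, differentiable maps.) For `A = univ` this is the usual (weak) `C¹`
topology. -/
abbrev c1TopologyOn (A : Set M) : TopologicalSpace (M → N) :=
  TopologicalSpace.induced (fun f => tangentMap 𝓘(ℝ, F) 𝓘(ℝ, E) f)
    (compactOpenOn {v : TangentBundle 𝓘(ℝ, F) M | v.proj ∈ A})

variable (F E) in
/-- The corresponding topology for one-parameter families `t ↦ (f_t : M → N)`: closeness of the
tangent maps `T f_t`, over the points of `A` and locally uniformly in `t`. Only derivatives
along `M` (and not along `t`) enter. -/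
abbrev c1FamilyTopologyOn (A : Set M) : TopologicalSpace (ℝ → M → N) :=
  TopologicalSpace.induced
    (fun f (p : ℝ × TangentBundle 𝓘(ℝ, F) M) => tangentMap 𝓘(ℝ, F) 𝓘(ℝ, E) (f p.1) p.2)
    (compactOpenOn {p : ℝ × TangentBundle 𝓘(ℝ, F) M | p.2.proj ∈ A})

variable (F E) in
/-- `C¹`-neighbourhoods on `A ⊆ M` of a map `f : M → N`. -/
def nhdsC1On (A : Set M) (f : M → N) : Filter (M → N) := @nhds _ (c1TopologyOn F E A) f

variable (F E) in
/-- `C¹`-neighbourhoods on `A ⊆ M` of a one-parameter family of maps `M → N`. -/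
def nhdsC1FamilyOn (A : Set M) (f : ℝ → M → N) : Filter (ℝ → M → N) :=
  @nhds _ (c1FamilyTopologyOn F E A) f

end C1

namespace LieGroupoid

variable {r : WithTop ℕ∞} {E F G M : Type*}
  [NormedAddCommGroup E] [NormedSpace ℝ E] [NormedAddCommGroup F] [NormedSpace ℝ F]
  [TopologicalSpace G] [ChartedSpace E G] [TopologicalSpace M] [ChartedSpace F M]

/-- The connected component `G_x°` of the unit `1_x` in the source fibre `G_x = α⁻¹(x)`. -/
def fiberComponent (𝒢 : LieGroupoid r E F G M) (x : M) : Set G :=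
  connectedComponentIn (𝒢.src ⁻¹' {x}) (𝒢.one x)

/-- The subset `G° = ⋃ x, G_x°` of `G`. -/
def unitComponent (𝒢 : LieGroupoid r E F G M) : Set G := ⋃ x, 𝒢.fiberComponent x

/-- The leaf `L_x = β(G_x°)` through `x` of the foliation of `M` determined by the groupoid. -/
def leaf (𝒢 : LieGroupoid r E F G M) (x : M) : Set M := 𝒢.tgt '' 𝒢.fiberComponent x

/-- The dimension of the source fibre `α⁻¹(x)`, whose tangent space at `1_x` is `ker d_{1_x} α`. -/
def fiberDim (𝒢 : LieGroupoid r E F G M) (x : M) : ℕ :=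
  Module.finrank ℝ (LinearMap.ker (mfderiv 𝓘(ℝ, E) 𝓘(ℝ, F) 𝒢.src (𝒢.one x)).toLinearMap)

/-- A bisection of class `C^r`: a `C^r` map `σ : M → G` with `α ∘ σ = id` such that `β ∘ σ` is
a `C^r` diffeomorphism of `M`. The (unique) diffeomorphism is recorded as `base`. -/
structure Bisection (𝒢 : LieGroupoid r E F G M) where
  toFun : M → G
  contMDiff_toFun : ContMDiff 𝓘(ℝ, F) 𝓘(ℝ, E) r toFun
  src_toFun : ∀ x, 𝒢.src (toFun x) = x
  base : Diffeomorph 𝓘(ℝ, F) 𝓘(ℝ, F) M M r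
  base_apply : ∀ x, base x = 𝒢.tgt (toFun x)

namespace Bisection

variable {𝒢 : LieGroupoid r E F G M}

theorem toFun_injective :
    Function.Injective (Bisection.toFun : Bisection 𝒢 → M → G) := by
  rintro ⟨f, hf, hs, b, hb⟩ ⟨f', hf', hs', b', hb'⟩ h
  obtain rfl : f = f' := h
  obtain rfl : b = b' := Diffeomorph.ext fun x => (hb x).trans (hb' x).symm
  rfl

instance : FunLike (Bisection 𝒢) M G where
  coe := Bisection.toFun
  coe_injective := toFun_injective

@[ext]
theorem ext {σ τ : Bisection 𝒢} (h : ∀ x, σ x = τ x) : σ = τ := DFunLike.ext _ _ h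

theorem src_apply (σ : Bisection 𝒢) (x : M) : 𝒢.src (σ x) = x := σ.src_toFun x

theorem tgt_apply (σ : Bisection 𝒢) (x : M) : 𝒢.tgt (σ x) = σ.base x := (σ.base_apply x).symm

theorem contMDiff (σ : Bisection 𝒢) : ContMDiff 𝓘(ℝ, F) 𝓘(ℝ, E) r σ := σ.contMDiff_toFun

/-- The unit bisection `ι_M`. -/
instance : One (Bisection 𝒢) where
  one :=
    { toFun := 𝒢.one
      contMDiff_toFun := 𝒢.contMDiff_one
      src_toFun := 𝒢.src_one
      base := Diffeomorph.refl 𝓘(ℝ, F) M r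
      base_apply := fun x => (𝒢.tgt_one x).symm }

/-- The product of bisections, `(σ ⋆ τ)(x) = σ(β(τ(x))).τ(x)`. -/
instance : Mul (Bisection 𝒢) where
  mul σ τ :=
    { toFun := fun x => 𝒢.mul (σ (𝒢.tgt (τ x))) (τ x)
      contMDiff_toFun := by
        have h : ContMDiff 𝓘(ℝ, F) (𝓘(ℝ, E).prod 𝓘(ℝ, E)) r
            (fun x => (σ (𝒢.tgt (τ x)), τ x)) :=
          (σ.contMDiff.comp (𝒢.isSubmersion_tgt.contMDiff.comp τ.contMDiff)).prodMk τ.contMDiff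
        exact 𝒢.contMDiffOn_mul.comp_contMDiff h fun x => σ.src_apply _
      src_toFun := fun x => by rw [𝒢.src_mul _ _ (σ.src_apply _), τ.src_apply]
      base := τ.base.trans σ.base
      base_apply := fun x => by
        rw [𝒢.tgt_mul _ _ (σ.src_apply _), σ.tgt_apply, τ.tgt_apply]
        rfl }

/-- The inverse of a bisection, `σ⁻¹(x) = σ((β ∘ σ)⁻¹(x))⁻¹`. -/
instance : Inv (Bisection 𝒢) where
  inv σ :=
    { toFun := fun x => 𝒢.inv (σ (σ.base.symm x))
      contMDiff_toFun :=
        𝒢.contMDiff_inv.comp (σ.contMDiff.comp σ.base.symm.contMDiff)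
      src_toFun := fun x => by rw [𝒢.src_inv, σ.tgt_apply, Diffeomorph.apply_symm_apply]
      base := σ.base.symm
      base_apply := fun x => by rw [𝒢.tgt_inv, σ.src_apply] }

theorem one_apply (x : M) : (1 : Bisection 𝒢) x = 𝒢.one x := rfl

theorem mul_apply (σ τ : Bisection 𝒢) (x : M) :
    (σ * τ) x = 𝒢.mul (σ (𝒢.tgt (τ x))) (τ x) := rfl

theorem inv_apply (σ : Bisection 𝒢) (x : M) : σ⁻¹ x = 𝒢.inv (σ (σ.base.symm x)) := rfl

/-- The group `Bis^r(G)` of all bisections of class `C^r`. -/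
instance : Group (Bisection 𝒢) where
  mul_assoc ρ σ τ := by
    ext x
    simp only [mul_apply]
    rw [𝒢.tgt_mul _ _ (σ.src_apply _), 𝒢.mul_assoc _ _ _ (ρ.src_apply _) (σ.src_apply _)]
  one_mul σ := by
    ext x
    rw [mul_apply, one_apply, 𝒢.one_mul]
  mul_one σ := by
    ext x
    have h := 𝒢.mul_one (σ x)
    rw [σ.src_apply] at h
    rw [mul_apply, one_apply, 𝒢.tgt_one, h]
  inv_mul_cancel σ := by
    ext x
    rw [mul_apply, one_apply, inv_apply, σ.tgt_apply, Diffeomorph.symm_apply_apply, 𝒢.inv_mul,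
      σ.src_apply]

/-- The support of a bisection: the closure of the set of points where it differs from `ι_M`. -/
def supp (σ : Bisection 𝒢) : Set M := closure {x | σ x ≠ 𝒢.one x}

/-- The support of the diffeomorphism `β ∘ σ` of `M`. -/
def baseSupp (σ : Bisection 𝒢) : Set M := closure {x | 𝒢.tgt (σ x) ≠ x}

end Bisection

variable {𝒢 : LieGroupoid r E F G M}

/-- The set `IΓ` of all `C^r`-isotopies `(σ_t)`, `t ∈ ℝ`, in `Γ` with `σ_0 = ι_M`. -/
def isotopies (Γ : Subgroup (Bisection 𝒢)) : Set (ℝ → Bisection 𝒢) :=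
  {σ | ContMDiff (𝓘(ℝ, ℝ).prod 𝓘(ℝ, F)) 𝓘(ℝ, E) r (fun p : ℝ × M => σ p.1 p.2) ∧
    (∀ t, σ t ∈ Γ) ∧ σ 0 = 1}

/-- The initial velocity `∂σ_t(x)/∂t` at `t = 0` of an isotopy. It belongs to the tangent space of
`G` at `σ_0(x) = 1_x`, which in Mathlib is the model space `E`. -/
def velocity (σ : ℝ → Bisection 𝒢) (x : M) : E :=
  mfderiv 𝓘(ℝ, ℝ) 𝓘(ℝ, E) (fun t : ℝ => σ t x) 0 (1 : ℝ)

/-- `Γ` is fiberwise transitive: for every `x` there are `k = dim α⁻¹(x)` isotopies in `Γ` whose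
initial velocities at `x` are linearly independent. -/
def FiberwiseTransitive (Γ : Subgroup (Bisection 𝒢)) : Prop :=
  ∀ x : M, ∃ σ : Fin (𝒢.fiberDim x) → ℝ → Bisection 𝒢,
    (∀ j, σ j ∈ isotopies Γ) ∧ LinearIndependent ℝ (fun j => velocity (σ j) x)

section Locality

variable [IsManifold 𝓘(ℝ, E) 1 G] [IsManifold 𝓘(ℝ, F) 1 M]

/-- The locality condition (L) for classes `1 ≤ r ≤ ∞`: for all relatively compact open `U`, `V`
with `closure U ⊆ V`, every isotopy in `Γ` sufficiently `C¹` close to `ι_M` agrees on `U` with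
an isotopy in `Γ` supported in `V`. -/
def SmoothLCondition (Γ : Subgroup (Bisection 𝒢)) : Prop :=
  ∀ U V : Set M, IsOpen U → IsCompact (closure U) → IsOpen V → IsCompact (closure V) →
    closure U ⊆ V →
    ∃ 𝒩 ∈ nhdsC1On F E univ 𝒢.one, ∀ σ ∈ isotopies Γ, (∀ t, ⇑(σ t) ∈ 𝒩) →
      ∃ τ ∈ isotopies Γ, ∀ t, EqOn (τ t) (σ t) U ∧ (τ t).supp ⊆ V

/-- The locality condition (L) for the class `r = ω`: for all relatively compact open `U`, `V`
with `closure U ⊆ V` and every isotopy `σ` in `Γ` sufficiently `C¹` close to `ι_M`, there are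
isotopies `τ` in `Γ` which are arbitrarily `C¹` close to `σ` on `U` and to `ι_M` outside `V`. -/
def AnalyticLCondition (Γ : Subgroup (Bisection 𝒢)) : Prop :=
  ∀ U V : Set M, IsOpen U → IsCompact (closure U) → IsOpen V → IsCompact (closure V) →
    closure U ⊆ V →
    ∃ 𝒩 ∈ nhdsC1On F E univ 𝒢.one, ∀ σ ∈ isotopies Γ, (∀ t, ⇑(σ t) ∈ 𝒩) →
      ∀ 𝒰 ∈ nhdsC1FamilyOn F E U (fun t => ⇑(σ t)),
      ∀ 𝒱 ∈ nhdsC1FamilyOn F E Vᶜ (fun _ => 𝒢.one),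
        ∃ τ ∈ isotopies Γ, (fun t => ⇑(τ t)) ∈ 𝒰 ∧ (fun t => ⇑(τ t)) ∈ 𝒱

/-- The locality condition (L), for all classes `1 ≤ r ≤ ω`. -/
def LCondition (Γ : Subgroup (Bisection 𝒢)) : Prop :=
  (r ≠ ω → SmoothLCondition Γ) ∧ (r = ω → AnalyticLCondition Γ)

end Locality

end LieGroupoid

end

/-! Fix a point `y`, with isotopies in `Γ` whose velocities at `y` form a basis of `ker d_{1_y} α`.
The map `(t, x) ↦ (σ¹_{t₁} ⋆ ⋯ ⋆ σᵏ_{tₖ})(x)` is a section of `α` for each fixed `t` and is `ι_M` at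
`t = 0`. Its derivative at `(0, y)` is therefore invertible (`exists_hasMFDerivAt_multiFlow`), and
all arrows near `1_y` are values of elements of `Γ`. For `g`, `h` in `G_x°`, consider the relation
"`h.g⁻¹` is a value at `β(g)` of an element of `Γ`". It holds in both directions for nearby arrows
and it is transitive, so connectedness of `G_x°` gives it for the pair `1_x`, `γ`
(`exists_frequently_apply_eq`). Local transitivity is used only at points `β(g)` of the leaf, which
lie in `V`, so supports can be controlled locally.

If `r ≠ ω`, condition (L) replaces the isotopies by isotopies supported in `V` and unchanged near
`y`. Their velocities at `y` are the same, and the elements of `Γ` supported in `V` form a subgroup.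

If `r = ω`, condition (L) yields only approximations, with no control of the derivatives in `t`, so
independence of the velocities may be lost and the inverse function theorem does not apply to the
approximating families. Uniform closeness is enough instead: by a Brouwer type argument, every `C¹`
map uniformly close to one with invertible derivative at a point still covers a fixed neighbourhood
(`HasFDerivAt.exists_nhds_subset_image_of_close`). "Arbitrarily close to the identity off `V`" is
expressed by the filters `nearIdOff Γ K` with `K ⊆ V` compact, and "can be chosen" by "frequently".
The chaining argument is stated for such systems of filters and covers both regularity classes.

The covering lemma rests on the no-retraction theorem, proved by the Milnor–Rogers volume argument:
the volume of the image of the ball under `x + t(f(x) - x)` is polynomial in `t` and constant for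
small `t`, whereas the Jacobian vanishes at `t = 1`. -/

noncomputable section

/-! ### A topological covering lemma of Brouwer type -/

section Covering

open MeasureTheory Metric

variable {X : Type*} [NormedAddCommGroup X] [InnerProductSpace ℝ X] [FiniteDimensional ℝ X]

/-- The determinant of `1 + A` is an affine combination of the determinants of the maps `1 + tᵢ A`,
with coefficients independent of `A`. -/
theorem exists_det_one_add_eq_sum {ι : Type*} [DecidableEq ι] (s : Finset ι) (v : ι → ℝ)
    (hv : InjOn v s) (hs : Module.finrank ℝ X < s.card) :
    ∃ c : ι → ℝ, ∀ A : X →L[ℝ] X,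
      (1 + A).det = ∑ i ∈ s, c i * (1 + v i • A).det := by
  refine ⟨fun i => (Lagrange.basis s v i).eval 1, fun A => ?_⟩
  let b := Module.finBasis ℝ X
  let N := LinearMap.toMatrix b b A.toLinearMap
  -- As a function of `t`, `det(1 + tA)` is a polynomial of degree at most `dim X`. Lagrange
  -- interpolation at more than `dim X` nodes recovers its value at `1`.
  let p : Polynomial ℝ := Matrix.det ((Polynomial.X : Polynomial ℝ) • N.map Polynomial.C +
    (1 : Matrix _ _ ℝ).map Polynomial.C)
  have hp : p.natDegree ≤ Module.finrank ℝ X := by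
    exact (Polynomial.natDegree_det_X_add_C_le N 1).trans_eq (Fintype.card_fin _)
  have heval : ∀ t : ℝ, p.eval t = (1 + t • A).det := by
    intro t
    have h1 : (1 + t • A).det = LinearMap.det (1 + t • A.toLinearMap) := rfl
    rw [h1, ← LinearMap.det_toMatrix b, ← Polynomial.coe_evalRingHom, RingHom.map_det]
    congr 1
    ext i j
    simp [N, LinearMap.toMatrix_one, Matrix.one_apply, apply_ite (Polynomial.eval t),
      RingHom.mapMatrix_apply]
    ring
  have hint : p = Lagrange.interpolate s v (fun i => p.eval (v i)) := by
    refine Lagrange.eq_interpolate hv (lt_of_le_of_lt Polynomial.degree_le_natDegree ?_)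
    exact_mod_cast hp.trans_lt hs
  have h1 := heval 1
  rw [one_smul] at h1
  rw [← h1]
  conv_lhs => rw [hint]
  rw [Lagrange.interpolate_apply, Polynomial.eval_finsetSum]
  refine Finset.sum_congr rfl fun i _ => ?_
  rw [Polynomial.eval_mul, Polynomial.eval_C, heval, mul_comm]

omit [FiniteDimensional ℝ X] in
/-- A Lipschitz map on a closed ball which vanishes on the sphere has a Lipschitz extension by zero. -/
theorem LipschitzOnWith.indicator_closedBall {u : X → X} {C : NNReal} {R : ℝ}
    (hu : LipschitzOnWith C u (closedBall 0 R)) (h0 : ∀ x, ‖x‖ = R → u x = 0) :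
    LipschitzWith C ((closedBall (0 : X) R).indicator u) := by
  -- The segment from `x` to `z` crosses the sphere, where `u` vanishes, at a point no farther from
  -- `x` than `z` is.
  have key : ∀ x ∈ closedBall (0 : X) R, ∀ z ∉ closedBall (0 : X) R, ‖u x‖ ≤ C * ‖x - z‖ := by
    intro x hx z hz
    have hcont : ContinuousOn (fun s : ℝ => ‖AffineMap.lineMap x z s‖) (Icc 0 1) := by
      have : Continuous fun s : ℝ => (AffineMap.lineMap x z s : X) := by fun_prop
      exact this.norm.continuousOn
    have hmem : R ∈ Icc ‖(AffineMap.lineMap x z (0 : ℝ) : X)‖ ‖(AffineMap.lineMap x z (1 : ℝ) : X)‖ := by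
      simp only [AffineMap.lineMap_apply_zero, AffineMap.lineMap_apply_one]
      simp only [mem_closedBall, dist_zero_right, not_le] at hx hz
      exact ⟨hx, hz.le⟩
    obtain ⟨s, hs, hsR⟩ := intermediate_value_Icc zero_le_one hcont hmem
    have hp : (AffineMap.lineMap x z s : X) ∈ closedBall (0 : X) R := by
      simpa using hsR.le
    have h1 := hu.dist_le_mul x hx _ hp
    rw [h0 _ hsR, dist_zero_right, dist_left_lineMap, dist_eq_norm, Real.norm_eq_abs,
      abs_of_nonneg hs.1] at h1
    refine h1.trans (mul_le_mul_of_nonneg_left ?_ C.2)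
    exact mul_le_of_le_one_left (norm_nonneg _) hs.2
  refine LipschitzWith.of_dist_le_mul fun x z => ?_
  by_cases hx : x ∈ closedBall (0 : X) R <;> by_cases hz : z ∈ closedBall (0 : X) R
  · simpa only [indicator_of_mem hx, indicator_of_mem hz] using hu.dist_le_mul x hx z hz
  · rw [indicator_of_mem hx, indicator_of_notMem hz, dist_zero_right, dist_eq_norm]
    exact key x hx z hz
  · rw [indicator_of_notMem hx, indicator_of_mem hz, dist_zero_left, dist_comm, dist_eq_norm]
    exact key z hz x hx
  · simp only [indicator_of_notMem hx, indicator_of_notMem hz, dist_self]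
    positivity

/-- A small Lipschitz perturbation of the identity of a closed ball, fixing the sphere and pointing
inwards, is a bijection of the ball. -/
theorem bijOn_closedBall_of_lipschitz {u : X → X} {C : NNReal} {R t : ℝ}
    (hu : LipschitzOnWith C u (closedBall 0 R)) (h0 : ∀ x, ‖x‖ = R → u x = 0)
    (hmaps : MapsTo (fun x => x + t • u x) (closedBall 0 R) (closedBall 0 R))
    (ht : 0 ≤ t) (htC : t * C < 1) :
    BijOn (fun x => x + t • u x) (closedBall 0 R) (closedBall 0 R) := by
  refine ⟨hmaps, fun x hx z hz hxz => ?_, fun z hz => ?_⟩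
  · have h1 : x - z = t • (u z - u x) := by
      have : x + t • u x = z + t • u z := hxz
      rw [smul_sub, sub_eq_sub_iff_add_eq_add, this, add_comm]
    have h2 : ‖x - z‖ ≤ (t * C) * ‖x - z‖ := by
      have h3 := hu.dist_le_mul z hz x hx
      rw [dist_eq_norm, dist_eq_norm, norm_sub_rev z x] at h3
      calc ‖x - z‖ = t * ‖u z - u x‖ := by
            conv_lhs => rw [h1, norm_smul, Real.norm_of_nonneg ht]
        _ ≤ t * (C * ‖x - z‖) := mul_le_mul_of_nonneg_left h3 ht
        _ = _ := by ring
    have h4 : ‖x - z‖ = 0 := by nlinarith [norm_nonneg (x - z)]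
    exact sub_eq_zero.1 (norm_eq_zero.1 h4)
  -- With `u` extended by zero, a preimage of `z` is a fixed point of the contraction `x ↦ z - t
  -- v(x)`. A fixed point outside the ball would equal `z`, which lies inside.
  · let v := (closedBall (0 : X) R).indicator u
    have hv : LipschitzWith C v := hu.indicator_closedBall h0
    have hc : ContractingWith (t.toNNReal * C) (fun x => z - t • v x) := by
      refine ⟨by rwa [← NNReal.coe_lt_coe, NNReal.coe_mul, Real.coe_toNNReal t ht], LipschitzWith.of_dist_le_mul fun x y => ?_⟩
      have h3 := hv.dist_le_mul x y
      rw [dist_eq_norm] at h3 ⊢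
      have : z - t • v x - (z - t • v y) = - (t • (v x - v y)) := by rw [smul_sub]; abel
      rw [this, norm_neg, norm_smul, Real.norm_of_nonneg ht]
      calc t * ‖v x - v y‖ ≤ t * (C * dist x y) := mul_le_mul_of_nonneg_left h3 ht
        _ = _ := by rw [NNReal.coe_mul, Real.coe_toNNReal t ht]; ring
    have hfix := hc.fixedPoint_isFixedPt
    set x := hc.fixedPoint
    have hx : x + t • v x = z := by
      have : z - t • v x = x := hfix
      exact (sub_eq_iff_eq_add.1 this).symm
    by_cases hxB : x ∈ closedBall (0 : X) R
    · refine ⟨x, hxB, ?_⟩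
      rwa [show v x = u x from indicator_of_mem hxB u] at hx
    · rw [show v x = 0 from indicator_of_notMem hxB u, smul_zero, add_zero] at hx
      exact absurd (hx ▸ hz) hxB

/-- There is no `C¹` retraction of a closed ball onto its boundary sphere. -/
theorem not_exists_contDiff_retraction {f : X → X} (hf : ContDiff ℝ 1 f) {R : ℝ} (hR : 0 < R)
    (hnorm : ∀ x, ‖f x‖ = R) (hfix : ∀ x, ‖x‖ = R → f x = x) : False := by
  borelize X
  let B : Set X := closedBall 0 R
  have hBc : IsCompact B := isCompact_closedBall 0 R
  have hdf : Continuous (fderiv ℝ f) := hf.continuous_fderiv one_ne_zero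
  let A : X → X →L[ℝ] X := fun x => fderiv ℝ f x - 1
  have hA : Continuous A := hdf.sub continuous_const
  have hder : ∀ x, HasFDerivAt f (fderiv ℝ f x) x := fun x =>
    (hf.differentiable one_ne_zero x).hasFDerivAt
  let u : X → X := fun x => f x - x
  have hu : ∀ x, HasFDerivAt u (A x) x := fun x => (hder x).sub (hasFDerivAt_id x)
  have hdetc : Continuous fun q : ℝ × X => (1 + q.1 • A q.2).det :=
    ContinuousLinearMap.continuous_det.comp (by fun_prop)
  obtain ⟨C, hC⟩ : ∃ C : NNReal, LipschitzOnWith C u B := by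
    obtain ⟨C, hC⟩ := hBc.exists_bound_of_continuousOn hA.continuousOn
    refine ⟨C.toNNReal, (convex_closedBall 0 R).lipschitzOnWith_of_nnnorm_hasFDerivWithin_le
      (fun x _ => (hu x).hasFDerivWithinAt) fun x hx => ?_⟩
    rw [← NNReal.coe_le_coe, coe_nnnorm]
    exact (hC x hx).trans (Real.le_coe_toNNReal C)
  have hpos : ∀ᶠ t in 𝓝 (0 : ℝ), ∀ x ∈ B, 0 < (1 + t • A x).det := by
    refine hBc.eventually_forall_of_forall_eventually fun x _ => ?_
    have : Filter.Tendsto (fun q : ℝ × X => (1 + q.1 • A q.2).det) (𝓝 (0, x)) (𝓝 1) := by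
      have h := hdetc.tendsto (0, x)
      have h1 : (1 + (0 : ℝ) • A x).det = 1 := by
        rw [zero_smul, add_zero]; exact LinearMap.det_id
      simpa only [h1] using h
    exact this.eventually (lt_mem_nhds one_pos)
  have hsmall : ∀ᶠ t in 𝓝 (0 : ℝ), t * (C : ℝ) < 1 ∧ t < 1 := by
    have h1 : Filter.Tendsto (fun t : ℝ => t * (C : ℝ)) (𝓝 0) (𝓝 (0 * (C : ℝ))) :=
      (continuous_id.mul continuous_const).tendsto 0
    rw [zero_mul] at h1
    exact (h1.eventually (gt_mem_nhds one_pos)).and (gt_mem_nhds one_pos)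
  obtain ⟨δ, hδ, hball⟩ := Metric.eventually_nhds_iff.1 (hpos.and hsmall)
  -- For small `t` the map permutes the ball and has positive Jacobian, so change of variables
  -- computes the integral.
  have hvol : ∀ t, 0 ≤ t → t < δ → ∫ x in B, (1 + t • A x).det = volume.real B := by
    intro t ht htδ
    obtain ⟨hp, hC1, ht1⟩ := @hball t (by rwa [Real.dist_0_eq_abs, abs_of_nonneg ht])
    have hbij : BijOn (fun x => x + t • u x) B B := by
      refine bijOn_closedBall_of_lipschitz hC (fun x hx => by simp [u, hfix x hx]) ?_ ht hC1
      intro x hx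
      have h1 : x + t • u x = (1 - t) • x + t • f x := by simp only [u]; module
      simp only [h1]
      refine (convex_closedBall (0 : X) R) hx ?_ (by linarith) ht (by ring)
      simpa using (hnorm x).le
    have h2 := integral_image_eq_integral_abs_det_fderiv_smul (μ := volume) (s := B)
      (f := fun x => x + t • u x) (f' := fun x => 1 + t • A x) hBc.measurableSet
      (fun x _ => ((hasFDerivAt_id x).add ((hu x).const_smul t)).hasFDerivWithinAt) hbij.injOn
      (fun _ => (1 : ℝ))
    rw [hbij.image_eq] at h2
    simp only [smul_eq_mul, mul_one, integral_const, measureReal_restrict_apply_univ] at h2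
    rw [h2]
    refine setIntegral_congr_fun hBc.measurableSet fun x hx => ?_
    exact (abs_of_pos (hp x hx)).symm
  let s := Finset.range (Module.finrank ℝ X + 1)
  -- Distinct nodes in the range where `hvol` applies; the shift by `2` makes even the first one
  -- strictly less than `δ`.
  let v : ℕ → ℝ := fun i => δ / (i + 2)
  have hv : InjOn v s := by
    intro i _ j _ hij
    have h1 : (i : ℝ) + 2 ≠ 0 := by positivity
    have h2 : (j : ℝ) + 2 ≠ 0 := by positivity
    simp only [v] at hij
    field_simp at hij
    have : (i : ℝ) = j := by linarith
    exact_mod_cast this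
  obtain ⟨c, hc⟩ := exists_det_one_add_eq_sum (X := X) s v hv (by simp [s])
  have hcsum : ∑ i ∈ s, c i = 1 := by
    have h := hc 0
    have h1 : (1 : X →L[ℝ] X).det = 1 := LinearMap.det_id
    simpa [h1] using h.symm
  have htotal : ∫ x in B, (1 + A x).det = volume.real B := by
    rw [show (fun x => (1 + A x).det) = fun x => ∑ i ∈ s, c i * (1 + v i • A x).det from
      funext fun x => hc (A x)]
    rw [integral_finsetSum]
    · calc ∑ i ∈ s, ∫ x in B, c i * (1 + v i • A x).det
          = ∑ i ∈ s, c i * volume.real B := by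
            refine Finset.sum_congr rfl fun i _ => ?_
            rw [integral_const_mul, hvol _ (by positivity)]
            rw [div_lt_iff₀ (by positivity)]
            nlinarith [(Nat.cast_nonneg i : (0 : ℝ) ≤ i)]
        _ = volume.real B := by rw [← Finset.sum_mul, hcsum, one_mul]
    · intro i _
      have h1 : Continuous fun x : X => (1 + v i • A x).det :=
        hdetc.comp (by fun_prop : Continuous fun x : X => (v i, x))
      exact (continuous_const.mul h1).continuousOn.integrableOn_compact hBc
  -- Since `‖f‖` is constant, the image of `Df(x)` is orthogonal to `f(x) ≠ 0`, so `Df(x)` is not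
  -- surjective.
  have hzero : ∀ x, (1 + A x).det = 0 := by
    intro x
    have h1 : 1 + A x = fderiv ℝ f x := by simp [A]
    rw [h1]
    by_contra hne
    have hort : ∀ w, inner ℝ (f x) (fderiv ℝ f x w) = 0 := by
      intro w
      have h2 := (hder x).norm_sq
      have h3 : HasFDerivAt (fun y => ‖f y‖ ^ 2) (0 : X →L[ℝ] ℝ) x := by
        simp only [hnorm]; exact hasFDerivAt_const _ _
      have h4 := congrArg (fun L : X →L[ℝ] ℝ => L w) (h2.unique h3)
      simpa using h4
    have hsurj : Function.Surjective (fderiv ℝ f x) :=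
      (LinearMap.equivOfDetNeZero (fderiv ℝ f x).toLinearMap hne).surjective
    obtain ⟨w, hw⟩ := hsurj (f x)
    have h5 := hort w
    rw [hw, real_inner_self_eq_norm_sq, hnorm] at h5
    exact hR.ne' (by simpa using h5)
  simp only [hzero, integral_zero] at htotal
  have hpos : 0 < volume B := measure_closedBall_pos volume 0 hR
  have : 0 < volume.real B := ENNReal.toReal_pos hpos.ne' hBc.measure_lt_top.ne
  exact this.ne htotal

/-- A `C¹` map which is close to the identity on a closed ball covers a smaller ball. -/
theorem ball_subset_image_closedBall {g : X → X} {O : Set X} {a : X} {ρ : ℝ} (hρ : 0 < ρ)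
    (hO : IsOpen O) (hg : ContDiffOn ℝ 1 g O) (haO : closedBall a ρ ⊆ O)
    (hclose : ∀ x ∈ closedBall a ρ, ‖g x - x‖ ≤ ρ / 4) :
    ball a (ρ / 4) ⊆ g '' closedBall a ρ := by
  intro y hy
  by_contra hyim
  -- Cutting off makes the map globally `C¹` and the identity far out. If `h x = y`, then `x` is
  -- within `ρ/4 + ρ/4` of `a`, where `χ = 1`; so `h` misses `y` as soon as `g` does. Radial
  -- projection from `y` then gives a forbidden retraction.
  let χ : ContDiffBump a := ⟨ρ / 2, 3 * ρ / 4, by positivity, by linarith⟩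
  let h : X → X := fun x => x + χ x • (g x - x)
  have hout : ∀ x ∉ closedBall a (3 * ρ / 4), h x = x := by
    intro x hx
    have : χ x = 0 := χ.zero_of_le_dist (by simpa using (not_le.1 hx).le)
    simp [h, this]
  have hh : ContDiff ℝ 1 h := by
    refine contDiff_iff_contDiffAt.2 fun x => ?_
    by_cases hx : x ∈ closedBall a (3 * ρ / 4)
    · have hxO : O ∈ 𝓝 x := hO.mem_nhds (haO (closedBall_subset_closedBall (by linarith) hx))
      exact contDiffAt_id.add (χ.contDiffAt.smul ((hg.contDiffAt hxO).sub contDiffAt_id))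
    · refine contDiffAt_id.congr_of_eventuallyEq ?_
      filter_upwards [isClosed_closedBall.isOpen_compl.mem_nhds hx] with z hz using hout z hz
  have hne : ∀ x, h x ≠ y := by
    intro x hxy
    rw [mem_ball] at hy
    have hxρ : x ∈ closedBall a ρ := by
      by_contra hx
      rw [hout x fun h => hx (closedBall_subset_closedBall (by linarith) h)] at hxy
      rw [hxy] at hx
      exact hx (by rw [mem_closedBall]; linarith)
    have h1 : ‖y - x‖ ≤ ρ / 4 := by
      rw [← hxy]
      simp only [h, add_sub_cancel_left, norm_smul, Real.norm_of_nonneg χ.nonneg]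
      exact (mul_le_of_le_one_left (norm_nonneg _) χ.le_one).trans (hclose x hxρ)
    have h2 : x ∈ closedBall a (ρ / 2) := by
      rw [mem_closedBall]
      have h3 := dist_triangle x y a
      rw [dist_comm x y, dist_eq_norm y x] at h3
      linarith
    have h3 : χ x = 1 := χ.one_of_mem_closedBall h2
    simp only [h, h3, one_smul, add_sub_cancel] at hxy
    exact hyim ⟨x, hxρ, hxy⟩
  have hpos : ∀ x, 0 < ‖h (x + y) - y‖ := fun x => norm_pos_iff.2 (sub_ne_zero.2 (hne _))
  let q : X → X := fun x => h (x + y) - y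
  have hq : ContDiff ℝ 1 q := (hh.comp (contDiff_id.add contDiff_const)).sub contDiff_const
  refine not_exists_contDiff_retraction (f := fun x => (2 * ρ / ‖q x‖) • q x) ?_
    (R := 2 * ρ) (by positivity) (fun x => ?_) fun x hx => ?_
  · exact (contDiff_const.div (hq.norm ℝ fun x => norm_pos_iff.1 (hpos x))
      fun x => (hpos x).ne').smul hq
  · rw [norm_smul, Real.norm_of_nonneg (by positivity), div_mul_cancel₀ _ (hpos x).ne']
  · have h1 : q x = x := by
      simp only [q]
      rw [hout, add_sub_cancel_right]
      intro hmem
      rw [mem_closedBall, dist_eq_norm] at hmem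
      rw [mem_ball, dist_eq_norm] at hy
      have : ‖x‖ ≤ ‖x + y - a‖ + ‖y - a‖ := by
        calc ‖x‖ = ‖(x + y - a) - (y - a)‖ := by congr 1; abel
          _ ≤ _ := norm_sub_le _ _
      linarith
    simp only [h1, hx]
    rw [div_self (by positivity), one_smul]

end Covering

/-- If `f` has an invertible derivative at `a`, then every `C¹` map which is uniformly close to `f`
near `a` covers a fixed neighbourhood of `f a`. -/
theorem HasFDerivAt.exists_nhds_subset_image_of_close {X Y : Type*}
    [NormedAddCommGroup X] [NormedSpace ℝ X] [FiniteDimensional ℝ X]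
    [NormedAddCommGroup Y] [NormedSpace ℝ Y]
    {f : X → Y} {L : X ≃L[ℝ] Y} {a : X} (hf : HasFDerivAt f (L : X →L[ℝ] Y) a)
    {s : Set X} (hs : s ∈ 𝓝 a) :
    ∃ K ⊆ s, IsCompact K ∧ ∃ ε > 0, ∃ 𝒪 ∈ 𝓝 (f a), ∀ (g : X → Y) (O : Set X), IsOpen O → K ⊆ O →
      ContDiffOn ℝ 1 g O → (∀ x ∈ K, ‖g x - f x‖ ≤ ε) → 𝒪 ⊆ g '' K := by
  -- Normalization to derivative `id` on a Euclidean space. Of the allowed error `ρ/4`, half is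
  -- spent on the linearization of `f` and half on the distance from `g` to `f`.
  let e := toEuclidean (E := X)
  let T := L.symm.trans e
  let norml : Y → EuclideanSpace ℝ (Fin (Module.finrank ℝ X)) := fun z => T (z - f a) + e a
  have hnorml : Continuous norml := by fun_prop
  have hnorml_smooth : ContDiff ℝ 1 norml :=
    (T.contDiff.comp (contDiff_id.sub contDiff_const)).add contDiff_const
  have hder : HasFDerivAt (fun w => norml (f (e.symm w)))
      (ContinuousLinearMap.id ℝ (EuclideanSpace ℝ (Fin (Module.finrank ℝ X)))) (e a) := by
    have h1 : HasFDerivAt f (L : X →L[ℝ] Y) (e.symm (e a)) := by simpa using hf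
    have h2 := (h1.comp (e a) e.symm.hasFDerivAt).sub_const (f a)
    have h3 := ((T : Y →L[ℝ] EuclideanSpace ℝ (Fin (Module.finrank ℝ X))).hasFDerivAt.comp
      (e a) h2).add_const (e a)
    refine h3.congr_fderiv (ContinuousLinearMap.ext fun w => ?_)
    simp [T]
  have hlittle : ∀ᶠ w in 𝓝 (e a), ‖norml (f (e.symm w)) - w‖ ≤ 1 / 8 * ‖w - e a‖ := by
    have h := hder.isLittleO.def (c := 1 / 8) (by norm_num)
    filter_upwards [h] with w hw
    have h1 : norml (f (e.symm w)) - w =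
        norml (f (e.symm w)) - norml (f (e.symm (e a))) - (w - e a) := by
      simp [norml]; abel
    rw [h1]
    exact hw
  have hs' : ∀ᶠ w in 𝓝 (e a), e.symm w ∈ s :=
    e.symm.continuous.continuousAt.eventually_mem (by simpa using hs)
  obtain ⟨ρ, hρ, hball⟩ := Metric.nhds_basis_closedBall.eventually_iff.1 (hlittle.and hs')
  have hT : 0 < ‖(T : Y →L[ℝ] EuclideanSpace ℝ (Fin (Module.finrank ℝ X)))‖ + 1 := by positivity
  refine ⟨e.symm '' Metric.closedBall (e a) ρ, ?_, (isCompact_closedBall _ _).image e.symm.continuous,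
    ρ / (8 * (‖(T : Y →L[ℝ] EuclideanSpace ℝ (Fin (Module.finrank ℝ X)))‖ + 1)), by positivity,
    norml ⁻¹' Metric.ball (e a) (ρ / 4), ?_, ?_⟩
  · rintro _ ⟨w, hw, rfl⟩
    exact (hball hw).2
  · refine hnorml.continuousAt.preimage_mem_nhds (Metric.isOpen_ball.mem_nhds ?_)
    simpa [norml] using hρ
  · intro g O hO hKO hg hclose z hz
    have hO' : IsOpen (e.symm ⁻¹' O) := hO.preimage e.symm.continuous
    have hcov := ball_subset_image_closedBall (g := fun w => norml (g (e.symm w))) hρ hO'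
      (hnorml_smooth.comp_contDiffOn (hg.comp e.symm.contDiff.contDiffOn fun w hw => hw))
      (fun w hw => hKO ⟨w, hw, rfl⟩) fun w hw => ?_
    · obtain ⟨w, hw, hwz⟩ := hcov hz
      refine ⟨e.symm w, ⟨w, hw, rfl⟩, ?_⟩
      simpa [norml] using hwz
    · have h1 := (hball hw).1
      have h2 := hclose (e.symm w) ⟨w, hw, rfl⟩
      have h3 : norml (g (e.symm w)) - norml (f (e.symm w)) = T (g (e.symm w) - f (e.symm w)) := by
        simp only [norml, map_sub]; abel
      have h4 : ‖T (g (e.symm w) - f (e.symm w))‖ ≤ ρ / 8 := by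
        refine ((T : Y →L[ℝ] EuclideanSpace ℝ (Fin (Module.finrank ℝ X))).le_opNorm _).trans ?_
        refine (mul_le_mul_of_nonneg_left h2 (norm_nonneg _)).trans ?_
        rw [← mul_div_assoc, div_le_div_iff₀ (by positivity) (by norm_num)]
        nlinarith [norm_nonneg (T : Y →L[ℝ] EuclideanSpace ℝ (Fin (Module.finrank ℝ X)))]
      have h5 : ‖w - e a‖ ≤ ρ := by simpa [dist_eq_norm] using hw
      calc ‖norml (g (e.symm w)) - w‖
          = ‖(norml (g (e.symm w)) - norml (f (e.symm w))) + (norml (f (e.symm w)) - w)‖ := by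
            congr 1; abel
        _ ≤ ρ / 8 + 1 / 8 * ρ := by
            refine (norm_add_le _ _).trans (add_le_add (h3 ▸ h4) (h1.trans ?_))
            gcongr
        _ = ρ / 4 := by ring

/-! ### Convergence in the `C¹` compact-open topology -/

section C1Convergence

open Filter

variable {F E E' : Type*} [NormedAddCommGroup F] [NormedSpace ℝ F]
  [NormedAddCommGroup E] [NormedSpace ℝ E] [NormedAddCommGroup E'] [NormedSpace ℝ E']
  {M N N' : Type*} [TopologicalSpace M] [ChartedSpace F M] [IsManifold 𝓘(ℝ, F) 1 M]
  [TopologicalSpace N] [ChartedSpace E N] [IsManifold 𝓘(ℝ, E) 1 N]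
  [TopologicalSpace N'] [ChartedSpace E' N'] [IsManifold 𝓘(ℝ, E') 1 N']
  {ι : Type*} {l : Filter ι}

theorem tendsto_nhdsC1On_iff {A : Set M} {f : M → N} {g : ι → M → N} :
    Tendsto g l (nhdsC1On F E A f) ↔
      ∀ K : Set (TangentBundle 𝓘(ℝ, F) M), (∀ v ∈ K, v.proj ∈ A) → IsCompact K →
        ∀ O : Set (TangentBundle 𝓘(ℝ, E) N), IsOpen O →
          MapsTo (tangentMap 𝓘(ℝ, F) 𝓘(ℝ, E) f) K O →
          ∀ᶠ i in l, MapsTo (tangentMap 𝓘(ℝ, F) 𝓘(ℝ, E) (g i)) K O := by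
  unfold nhdsC1On
  rw [@nhds_induced _ _ (compactOpenOn _), tendsto_comap_iff,
    TopologicalSpace.tendsto_nhds_generateFrom_iff]
  constructor
  · intro h K hKA hK O hO hf
    exact h {u | MapsTo u K O} ⟨K, hKA, hK, O, hO, rfl⟩ hf
  · rintro h _ ⟨K, hKA, hK, O, hO, rfl⟩ hf
    exact h K hKA hK O hO hf

theorem tendsto_nhdsC1FamilyOn_iff {A : Set M} {f : ℝ → M → N} {g : ι → ℝ → M → N} :
    Tendsto g l (nhdsC1FamilyOn F E A f) ↔
      ∀ K : Set (ℝ × TangentBundle 𝓘(ℝ, F) M), (∀ p ∈ K, p.2.proj ∈ A) → IsCompact K →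
        ∀ O : Set (TangentBundle 𝓘(ℝ, E) N), IsOpen O →
          MapsTo (fun p : ℝ × TangentBundle 𝓘(ℝ, F) M =>
            tangentMap 𝓘(ℝ, F) 𝓘(ℝ, E) (f p.1) p.2) K O →
          ∀ᶠ i in l, MapsTo (fun p : ℝ × TangentBundle 𝓘(ℝ, F) M =>
            tangentMap 𝓘(ℝ, F) 𝓘(ℝ, E) (g i p.1) p.2) K O := by
  unfold nhdsC1FamilyOn
  rw [@nhds_induced _ _ (compactOpenOn _), tendsto_comap_iff,
    TopologicalSpace.tendsto_nhds_generateFrom_iff]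
  constructor
  · intro h K hKA hK O hO hf
    exact h {u | MapsTo u K O} ⟨K, hKA, hK, O, hO, rfl⟩ hf
  · rintro h _ ⟨K, hKA, hK, O, hO, rfl⟩ hf
    exact h K hKA hK O hO hf

theorem nhdsC1On_anti {A B : Set M} (hAB : A ⊆ B) (f : M → N) :
    nhdsC1On F E B f ≤ nhdsC1On F E A f := by
  have h : Tendsto (fun g => g) (nhdsC1On F E B f) (nhdsC1On F E B f) := tendsto_id
  have h' : Tendsto (fun g => g) (nhdsC1On F E B f) (nhdsC1On F E A f) := by
    rw [tendsto_nhdsC1On_iff] at h ⊢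
    exact fun K hK => h K fun v hv => hAB (hK v hv)
  exact h'

/-- On an open set, composition of differentiable maps is continuous at the identity for the `C¹`
compact-open topology. -/
theorem tendsto_comp_nhdsC1On_id [FiniteDimensional ℝ F] {W : Set M} (hW : IsOpen W)
    {f g : ι → M → M} (hf : ∀ i, MDifferentiable 𝓘(ℝ, F) 𝓘(ℝ, F) (f i))
    (hg : ∀ i, MDifferentiable 𝓘(ℝ, F) 𝓘(ℝ, F) (g i))
    (hft : Tendsto f l (nhdsC1On F F W id)) (hgt : Tendsto g l (nhdsC1On F F W id)) :
    Tendsto (fun i => f i ∘ g i) l (nhdsC1On F F W id) := by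
  have : LocallyCompactSpace (ModelProd F F) := inferInstanceAs (LocallyCompactSpace (F × F))
  have : LocallyCompactSpace (TangentBundle 𝓘(ℝ, F) M) :=
    ChartedSpace.locallyCompactSpace (ModelProd F F) _
  rw [tendsto_nhdsC1On_iff] at hft hgt ⊢
  intro K hKW hK O hO hKO
  rw [tangentMap_id] at hKO
  have hW' : IsOpen {v : TangentBundle 𝓘(ℝ, F) M | v.proj ∈ W} :=
    hW.preimage (FiberBundle.continuous_proj F (TangentSpace 𝓘(ℝ, F) (M := M)))
  -- `T g_i` moves `K` only slightly, into the compact buffer `K'` on which `T f_i` is controlled.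
  -- Openness of `W` leaves room for this buffer over `W`.
  obtain ⟨K', hK', hKK', hK'O⟩ := exists_compact_between hK (hO.inter hW')
    fun v hv => ⟨hKO hv, hKW v hv⟩
  filter_upwards [hft K' (fun v hv => (hK'O hv).2) hK' O hO
      (by rw [tangentMap_id]; exact fun v hv => (hK'O hv).1),
    hgt K hKW hK (interior K') isOpen_interior (by rw [tangentMap_id]; exact hKK')] with i hi1 hi2
  intro v hv
  rw [tangentMap_comp (hf i) (hg i)]
  exact hi1 (interior_subset (hi2 hv))

/-- If a family tends to a constant family, then its composition with a fixed `C¹` map is close to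
the corresponding map, uniformly for bounded times. -/
theorem Filter.Tendsto.comp_nhdsC1FamilyOn_const {A : Set M} {f : ι → ℝ → M → N} {f₀ : M → N}
    {b : N → N'} (hb : ContMDiff 𝓘(ℝ, E) 𝓘(ℝ, E') 1 b)
    (hf₀ : MDifferentiable 𝓘(ℝ, F) 𝓘(ℝ, E) f₀)
    (hf : ∀ i t, MDifferentiable 𝓘(ℝ, F) 𝓘(ℝ, E) (f i t))
    (h : Tendsto f l (nhdsC1FamilyOn F E A fun _ => f₀)) {T : Set ℝ} (hT : IsCompact T) :
    Tendsto (fun q : ι × ℝ => b ∘ f q.1 q.2) (l ×ˢ 𝓟 T) (nhdsC1On F E' A (b ∘ f₀)) := by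
  rw [tendsto_nhdsC1FamilyOn_iff] at h
  rw [tendsto_nhdsC1On_iff]
  intro K hKA hK O hO hKO
  have hbd : MDifferentiable 𝓘(ℝ, E) 𝓘(ℝ, E') b := hb.mdifferentiable one_ne_zero
  rw [tangentMap_comp hbd hf₀] at hKO
  have h1 := h (T ×ˢ K) (fun p hp => hKA _ hp.2) (hT.prod hK) _
    (hO.preimage (hb.continuous_tangentMap le_rfl)) fun p hp => hKO hp.2
  filter_upwards [prod_mem_prod h1 (mem_principal_self T)] with q hq v hv
  rw [tangentMap_comp hbd (hf q.1 q.2)]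
  exact hq.1 (show (q.2, v) ∈ T ×ˢ K from ⟨hq.2, hv⟩)

/-- Convergence of families in the `C¹` compact-open topology implies continuous convergence. -/
theorem Filter.Tendsto.nhdsC1FamilyOn_continuous [FiniteDimensional ℝ F]
    {U : Set M} (hU : IsOpen U) {f : ι → ℝ → M → N} {f₀ : ℝ → M → N}
    (hf₀ : Continuous fun p : ℝ × M => f₀ p.1 p.2)
    (h : Tendsto f l (nhdsC1FamilyOn F E U f₀)) {p : ℝ × M} (hp : p.2 ∈ U) :
    Tendsto (fun q : ι × (ℝ × M) => f q.1 q.2.1 q.2.2) (l ×ˢ 𝓝 p) (𝓝 (f₀ p.1 p.2)) := by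
  have : LocallyCompactSpace M := ChartedSpace.locallyCompactSpace F M
  rw [tendsto_nhdsC1FamilyOn_iff] at h
  refine tendsto_nhds.2 fun O hO hpO => ?_
  have h1 : IsOpen ({q : ℝ × M | f₀ q.1 q.2 ∈ O} ∩ {q | q.2 ∈ U}) :=
    (hO.preimage hf₀).inter (hU.preimage continuous_snd)
  obtain ⟨K, hK, hpK, hKO⟩ := exists_compact_subset h1 ⟨hpO, hp⟩
  -- Values of the maps are read off from their tangent maps on zero vectors.
  let z : M → TangentBundle 𝓘(ℝ, F) M := Bundle.zeroSection F (TangentSpace 𝓘(ℝ, F) (M := M))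
  have hz : Continuous z :=
    (Bundle.contMDiff_zeroSection (n := 0) ℝ (TangentSpace 𝓘(ℝ, F) (M := M))
      (IB := 𝓘(ℝ, F))).continuous
  have h2 := h (Prod.map id z '' K) (by rintro _ ⟨q, hq, rfl⟩; exact (hKO hq).2)
    (hK.image (continuous_id.prodMap hz)) _
    (hO.preimage (FiberBundle.continuous_proj E (TangentSpace 𝓘(ℝ, E) (M := N))))
    (by rintro _ ⟨q, hq, rfl⟩; exact (hKO hq).1)
  filter_upwards [prod_mem_prod h2 (mem_interior_iff_mem_nhds.1 hpK)] with q hq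
  exact hq.1 ⟨q.2, hq.2, rfl⟩

/-- The tangent maps `T f_t` of a `C¹` family of maps depend continuously on `t`. -/
theorem ContMDiff.continuous_tangentMap_family {f : ℝ → M → N}
    (hf : ContMDiff (𝓘(ℝ, ℝ).prod 𝓘(ℝ, F)) 𝓘(ℝ, E) 1 fun p : ℝ × M => f p.1 p.2) :
    Continuous fun p : ℝ × TangentBundle 𝓘(ℝ, F) M =>
      tangentMap 𝓘(ℝ, F) 𝓘(ℝ, E) (f p.1) p.2 := by
  -- `T f_t (v)` is the tangent map of the joint map at `(0_t, v)`, hence jointly continuous.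
  let z : ℝ → TangentBundle 𝓘(ℝ, ℝ) ℝ := Bundle.zeroSection ℝ (TangentSpace 𝓘(ℝ, ℝ) (M := ℝ))
  have hz : Continuous z :=
    (Bundle.contMDiff_zeroSection (n := 0) ℝ (TangentSpace 𝓘(ℝ, ℝ) (M := ℝ))
      (IB := 𝓘(ℝ, ℝ))).continuous
  have he : Continuous (equivTangentBundleProd 𝓘(ℝ, ℝ) ℝ 𝓘(ℝ, F) M).symm :=
    (contMDiff_equivTangentBundleProd_symm (n := 0)).continuous
  have hfc := (hf.continuous_tangentMap le_rfl).comp (he.comp (hz.prodMap continuous_id))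
  refine hfc.congr fun ⟨t, v⟩ => ?_
  have hι : MDifferentiable 𝓘(ℝ, F) (𝓘(ℝ, ℝ).prod 𝓘(ℝ, F)) (fun x : M => (t, x)) :=
    (contMDiff_const.prodMk contMDiff_id : ContMDiff _ _ 1 _).mdifferentiable one_ne_zero
  have h1 : (equivTangentBundleProd 𝓘(ℝ, ℝ) ℝ 𝓘(ℝ, F) M).symm (z t, v) =
      tangentMap 𝓘(ℝ, F) (𝓘(ℝ, ℝ).prod 𝓘(ℝ, F)) (fun x : M => (t, x)) v := by
    rw [Equiv.symm_apply_eq, equivTangentBundleProd_eq_tangentMap_prod_tangentMap]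
    refine Prod.ext ?_ ?_
    · refine Eq.trans ?_ (congrFun (tangentMap_comp mdifferentiable_fst hι) v)
      have : (Prod.fst ∘ fun x : M => (t, x)) = fun _ => t := rfl
      rw [this, tangentMap, mfderiv_const]
      rfl
    · refine Eq.trans ?_ (congrFun (tangentMap_comp mdifferentiable_snd hι) v)
      have : (Prod.snd ∘ fun x : M => (t, x)) = id := rfl
      rw [this, tangentMap_id]
      rfl
  have h2 := tangentMap_comp (hf.mdifferentiable one_ne_zero) hι
  have h3 := congrFun h2 v
  simp only [Function.comp_apply, Prod.map_apply, id] at h3 ⊢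
  rw [h1, ← h3]
  rfl

/-- A `C¹` family of maps is continuous in time for the `C¹` compact-open topology. -/
theorem ContMDiff.tendsto_nhdsC1On_family {f : ℝ → M → N}
    (hf : ContMDiff (𝓘(ℝ, ℝ).prod 𝓘(ℝ, F)) 𝓘(ℝ, E) 1 fun p : ℝ × M => f p.1 p.2)
    (A : Set M) (t : ℝ) : Tendsto f (𝓝 t) (nhdsC1On F E A (f t)) := by
  rw [tendsto_nhdsC1On_iff]
  intro K _ hK O hO hKO
  exact hK.eventually_forall_of_forall_eventually fun v hv =>
    hf.continuous_tangentMap_family.continuousAt.eventually_mem (hO.mem_nhds (hKO hv))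

end C1Convergence

namespace LieGroupoid

open Filter

variable {r : WithTop ℕ∞} {E F G M : Type*}
  [NormedAddCommGroup E] [NormedSpace ℝ E] [NormedAddCommGroup F] [NormedSpace ℝ F]
  [TopologicalSpace G] [ChartedSpace E G] [TopologicalSpace M] [ChartedSpace F M]
  {𝒢 : LieGroupoid r E F G M}

/-! ### Continuity of the structure maps -/

theorem contMDiff_src : ContMDiff 𝓘(ℝ, E) 𝓘(ℝ, F) r 𝒢.src := 𝒢.isSubmersion_src.contMDiff

theorem contMDiff_tgt : ContMDiff 𝓘(ℝ, E) 𝓘(ℝ, F) r 𝒢.tgt := 𝒢.isSubmersion_tgt.contMDiff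

theorem continuous_tgt : Continuous 𝒢.tgt := contMDiff_tgt.continuous

theorem continuous_inv : Continuous 𝒢.inv := 𝒢.contMDiff_inv.continuous

theorem inv_one (x : M) : 𝒢.inv (𝒢.one x) = 𝒢.one x := by
  have h1 := 𝒢.mul_one (𝒢.inv (𝒢.one x))
  rw [𝒢.src_inv, 𝒢.tgt_one, 𝒢.inv_mul, 𝒢.src_one] at h1
  exact h1.symm

theorem tendsto_mul {ι : Type*} {l : Filter ι} {a b : ι → G} {g h : G}
    (hab : ∀ i, 𝒢.src (a i) = 𝒢.tgt (b i)) (hgh : 𝒢.src g = 𝒢.tgt h)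
    (ha : Tendsto a l (𝓝 g)) (hb : Tendsto b l (𝓝 h)) :
    Tendsto (fun i => 𝒢.mul (a i) (b i)) l (𝓝 (𝒢.mul g h)) := by
  have h1 : ContinuousWithinAt (fun p : G × G => 𝒢.mul p.1 p.2) {p | 𝒢.src p.1 = 𝒢.tgt p.2} (g, h) :=
    𝒢.contMDiffOn_mul.continuousOn (g, h) hgh
  exact h1.tendsto.comp (tendsto_nhdsWithin_iff.2 ⟨ha.prodMk_nhds hb, Eventually.of_forall hab⟩)

/-! ### Smooth families of bisections -/

/-- A family of bisections with parameters in a normed space is smooth if it is jointly `C^r`. -/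
def SmoothFamily {W : Type*} [NormedAddCommGroup W] [NormedSpace ℝ W] (Φ : W → Bisection 𝒢) : Prop :=
  ContMDiff (𝓘(ℝ, W).prod 𝓘(ℝ, F)) 𝓘(ℝ, E) r fun p : W × M => Φ p.1 p.2

section Families

variable {W W' : Type*} [NormedAddCommGroup W] [NormedSpace ℝ W]
  [NormedAddCommGroup W'] [NormedSpace ℝ W']

theorem smoothFamily_one : SmoothFamily fun _ : W => (1 : Bisection 𝒢) :=
  𝒢.contMDiff_one.comp contMDiff_snd

theorem SmoothFamily.mul {Φ Ψ : W → Bisection 𝒢} (hΦ : SmoothFamily Φ) (hΨ : SmoothFamily Ψ) :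
    SmoothFamily fun p => Φ p * Ψ p := by
  have h1 : ContMDiff (𝓘(ℝ, W).prod 𝓘(ℝ, F)) 𝓘(ℝ, E) r
      fun p : W × M => Φ p.1 (𝒢.tgt (Ψ p.1 p.2)) :=
    hΦ.comp (contMDiff_fst.prodMk (contMDiff_tgt.comp hΨ))
  exact 𝒢.contMDiffOn_mul.comp_contMDiff (h1.prodMk hΨ) fun p => (Φ p.1).src_apply _

theorem SmoothFamily.comp {Φ : W → Bisection 𝒢} (hΦ : SmoothFamily Φ) {f : W' → W}
    (hf : ContDiff ℝ r f) : SmoothFamily fun p => Φ (f p) :=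
  ContMDiff.comp (g := fun p : W × M => Φ p.1 p.2) hΦ
    ((hf.contMDiff.comp contMDiff_fst).prodMk contMDiff_snd)

theorem SmoothFamily.listProd {ι : Type*} {Φ : ι → W → Bisection 𝒢} (hΦ : ∀ j, SmoothFamily (Φ j))
    (L : List ι) : SmoothFamily fun p => (L.map fun j => Φ j p).prod := by
  induction L with
  | nil => simpa using smoothFamily_one
  | cons j L ih => simpa using (hΦ j).mul ih

end Families

/-- The product `σ¹_{t₁} ⋆ ⋯ ⋆ σᵏ_{tₖ}` of the members of several one-parameter families. -/
def multiFlow {k : ℕ} (σ : Fin k → ℝ → Bisection 𝒢) (t : Fin k → ℝ) : Bisection 𝒢 :=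
  ((List.finRange k).map fun j => σ j (t j)).prod

section MultiFlow

variable {k : ℕ} {σ : Fin k → ℝ → Bisection 𝒢}

theorem smoothFamily_multiFlow (hσ : ∀ j, SmoothFamily (σ j)) : SmoothFamily (multiFlow σ) :=
  SmoothFamily.listProd (Φ := fun j (t : Fin k → ℝ) => σ j (t j))
    (fun j => (hσ j).comp (contDiff_apply ℝ ℝ j)) _

theorem multiFlow_zero (h0 : ∀ j, σ j 0 = 1) : multiFlow σ 0 = 1 := by
  refine List.prod_eq_one fun x hx => ?_
  obtain ⟨j, _, rfl⟩ := List.mem_map.1 hx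
  exact h0 j

theorem multiFlow_single (h0 : ∀ j, σ j 0 = 1) (j : Fin k) (s : ℝ) :
    multiFlow σ (Pi.single j s) = σ j s := by
  have h1 := List.prod_map_eq_pow_single (l := List.finRange k) j
    (fun i => σ i ((Pi.single j s : Fin k → ℝ) i))
    fun i hi _ => by simp only [Pi.single_eq_of_ne hi, h0]
  rw [multiFlow, h1, List.count_eq_one_of_mem (List.nodup_finRange k) (List.mem_finRange j), pow_one,
    Pi.single_eq_same]

theorem multiFlow_mem {Γ : Subgroup (Bisection 𝒢)} (hσ : ∀ j s, σ j s ∈ Γ) (t : Fin k → ℝ) :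
    multiFlow σ t ∈ Γ := by
  refine Subgroup.list_prod_mem _ fun x hx => ?_
  obtain ⟨j, _, rfl⟩ := List.mem_map.1 hx
  exact hσ j _

/-- Continuous convergence of one-parameter families on `U` implies continuous convergence of
their products near `(0, y)`, for `y ∈ U`. -/
theorem eventually_tendsto_listProd {U : Set M} (hU : IsOpen U) {y : M} (hy : y ∈ U)
    {l : Filter (Fin k → ℝ → Bisection 𝒢)} (hσ : ∀ j, SmoothFamily (σ j)) (h0 : ∀ j, σ j 0 = 1)
    (hl : ∀ j, ∀ p : ℝ × M, p.2 ∈ U →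
      Tendsto (fun q : (Fin k → ℝ → Bisection 𝒢) × (ℝ × M) => q.1 j q.2.1 q.2.2) (l ×ˢ 𝓝 p)
        (𝓝 (σ j p.1 p.2))) (L : List (Fin k)) :
    ∀ᶠ p : (Fin k → ℝ) × M in 𝓝 (0, y),
      Tendsto (fun q : (Fin k → ℝ → Bisection 𝒢) × ((Fin k → ℝ) × M) =>
        (L.map fun j => q.1 j (q.2.1 j)).prod q.2.2) (l ×ˢ 𝓝 p)
        (𝓝 ((L.map fun j => σ j (p.1 j)).prod p.2)) := by
  induction L with
  | nil =>
    refine Eventually.of_forall fun p => ?_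
    simp only [List.map_nil, List.prod_nil, Bisection.one_apply]
    exact (𝒢.contMDiff_one.continuous.tendsto p.2).comp
      ((continuous_snd.tendsto p).comp tendsto_snd)
  | cons j L ih =>
    have hsmooth := SmoothFamily.listProd (Φ := fun j (t : Fin k → ℝ) => σ j (t j))
      (fun j => (hσ j).comp (contDiff_apply ℝ ℝ j)) L
    have hone : (L.map fun j => σ j ((0 : Fin k → ℝ) j)).prod = 1 := by
      refine List.prod_eq_one fun x hx => ?_
      obtain ⟨i, _, rfl⟩ := List.mem_map.1 hx
      exact h0 i
    -- The next factor is evaluated at the target of the partial product. At `(0, y)` this target is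
    -- `y`, so it stays in `U`, where convergence is known, for `p` near `(0, y)`.
    have hUev : ∀ᶠ p : (Fin k → ℝ) × M in 𝓝 (0, y),
        𝒢.tgt ((L.map fun j => σ j (p.1 j)).prod p.2) ∈ U := by
      refine (continuous_tgt.comp hsmooth.continuous).continuousAt.eventually_mem (hU.mem_nhds ?_)
      simpa only [Function.comp_apply, hone, Bisection.one_apply, 𝒢.tgt_one] using hy
    filter_upwards [ih, hUev] with p hp hpU
    simp only [List.map_cons, List.prod_cons, Bisection.mul_apply]
    refine tendsto_mul (fun q => Bisection.src_apply _ _) (Bisection.src_apply _ _) ?_ hp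
    have h1 := hl j (p.1 j, 𝒢.tgt ((L.map fun j => σ j (p.1 j)).prod p.2)) hpU
    have h2 : Tendsto (fun q : (Fin k → ℝ → Bisection 𝒢) × ((Fin k → ℝ) × M) =>
        (q.1, (q.2.1 j, 𝒢.tgt ((L.map fun j => q.1 j (q.2.1 j)).prod q.2.2)))) (l ×ˢ 𝓝 p)
        (l ×ˢ 𝓝 (p.1 j, 𝒢.tgt ((L.map fun j => σ j (p.1 j)).prod p.2))) := by
      refine tendsto_fst.prodMk (Tendsto.prodMk_nhds ?_ ((continuous_tgt.tendsto _).comp hp))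
      exact (((continuous_apply j).comp continuous_fst).tendsto p).comp tendsto_snd
    exact h1.comp h2

/-- The derivative at `(0, y)` of `(t, x) ↦ (σ¹_{t₁} ⋆ ⋯ ⋆ σᵏ_{tₖ})(x)` is invertible if
the initial velocities of the families at `y` form a basis of the tangent space of the source fibre. -/
theorem exists_hasMFDerivAt_multiFlow [FiniteDimensional ℝ E] [FiniteDimensional ℝ F] (hr : 1 ≤ r)
    {y : M} (hk : k = 𝒢.fiberDim y) (hσ : ∀ j, SmoothFamily (σ j))
    (h0 : ∀ j, σ j 0 = 1) (hind : LinearIndependent ℝ fun j => velocity (σ j) y) :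
    ∃ L : ((Fin k → ℝ) × F) ≃L[ℝ] E,
      HasMFDerivAt (𝓘(ℝ, Fin k → ℝ).prod 𝓘(ℝ, F)) 𝓘(ℝ, E)
        (fun p : (Fin k → ℝ) × M => multiFlow σ p.1 p.2) (0, y)
        (L : ((Fin k → ℝ) × F) →L[ℝ] E) := by
  have hr0 : r ≠ 0 := (zero_lt_one.trans_le hr).ne'
  let Ψ : (Fin k → ℝ) × M → G := fun p => multiFlow σ p.1 p.2
  have hΨ : MDifferentiableAt (𝓘(ℝ, Fin k → ℝ).prod 𝓘(ℝ, F)) 𝓘(ℝ, E) Ψ (0, y) :=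
    (smoothFamily_multiFlow hσ).mdifferentiable hr0 (0, y)
  have hΨ0 : Ψ (0, y) = 𝒢.one y := by
    simp only [Ψ, multiFlow_zero h0, Bisection.one_apply]
  let D : ((Fin k → ℝ) × F) →L[ℝ] E :=
    mfderiv (𝓘(ℝ, Fin k → ℝ).prod 𝓘(ℝ, F)) 𝓘(ℝ, E) Ψ (0, y)
  let dsrc : E →L[ℝ] F := mfderiv 𝓘(ℝ, E) 𝓘(ℝ, F) 𝒢.src (𝒢.one y)
  have hsrc : MDifferentiableAt 𝓘(ℝ, E) 𝓘(ℝ, F) 𝒢.src (Ψ (0, y)) :=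
    contMDiff_src.mdifferentiable hr0 _
  -- Since `α ∘ Ψ` is the projection to `M`, a kernel vector of `D` has no component along `M`;
  -- independence of the velocities then kills its `t`-component.
  have hsnd : ∀ q, dsrc (D q) = q.2 := by
    intro q
    have h1 := mfderiv_comp (0, y) hsrc hΨ
    have h2 : 𝒢.src ∘ Ψ = Prod.snd := funext fun p => (multiFlow σ p.1).src_apply p.2
    rw [h2, mfderiv_snd, hΨ0] at h1
    exact (congrArg (fun T : ((Fin k → ℝ) × F) →L[ℝ] F => T q) h1).symm
  have hvel : ∀ j, D (Pi.single j 1, 0) = velocity (σ j) y := by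
    intro j
    have h1 : HasMFDerivAt 𝓘(ℝ, ℝ) (𝓘(ℝ, Fin k → ℝ).prod 𝓘(ℝ, F))
        (fun s : ℝ => ((Pi.single j s : Fin k → ℝ), y)) 0
        ((ContinuousLinearMap.single ℝ (fun _ : Fin k => ℝ) j).prod 0) :=
      (ContinuousLinearMap.single ℝ (fun _ : Fin k => ℝ) j).hasMFDerivAt.prodMk
        (hasMFDerivAt_const _ _)
    have hp : ((Pi.single j (0 : ℝ) : Fin k → ℝ), y) = (0, y) := by simp
    have hΨ' : HasMFDerivAt (𝓘(ℝ, Fin k → ℝ).prod 𝓘(ℝ, F)) 𝓘(ℝ, E) Ψ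
        ((Pi.single j (0 : ℝ) : Fin k → ℝ), y) D := by
      rw [hp]; exact hΨ.hasMFDerivAt
    have h2 := (hΨ'.comp (0 : ℝ) h1).mfderiv
    have h3 : (Ψ ∘ fun s : ℝ => ((Pi.single j s : Fin k → ℝ), y)) = fun s => σ j s y :=
      funext fun s => congrArg (fun τ : Bisection 𝒢 => τ y) (multiFlow_single h0 j s)
    rw [h3] at h2
    have h4 := congrArg (fun T : ℝ →L[ℝ] E => T 1) h2
    exact h4.symm
  have hinj : Function.Injective D := by
    rw [injective_iff_map_eq_zero]
    rintro ⟨c, w⟩ hcw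
    have hw : w = 0 := by
      have := hsnd (c, w)
      rw [hcw, map_zero] at this
      exact this.symm
    subst hw
    have h1 : D (c, 0) = ∑ j, c j • velocity (σ j) y := by
      have h2 : ((c, 0) : (Fin k → ℝ) × F) = ∑ j, c j • ((Pi.single j 1 : Fin k → ℝ), (0 : F)) := by
        refine Prod.ext ?_ ?_
        · rw [Prod.fst_sum]
          simp only [Prod.smul_fst]
          exact pi_eq_sum_univ' c
        · simp [Prod.snd_sum]
      rw [h2, map_sum]
      simp only [map_smul, hvel]
    have h3 := Fintype.linearIndependent_iff.1 hind c (h1.symm.trans hcw)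
    exact Prod.ext (funext h3) rfl
  have hsurj : Function.Surjective dsrc := fun w => ⟨D (0, w), hsnd (0, w)⟩
  -- `dα` is surjective with kernel of dimension `k`, so injectivity of `D` suffices.
  have hdim : Module.finrank ℝ ((Fin k → ℝ) × F) = Module.finrank ℝ E := by
    have h1 := LinearMap.finrank_range_add_finrank_ker dsrc.toLinearMap
    rw [LinearMap.range_eq_top.2 hsurj, finrank_top] at h1
    rw [Module.finrank_prod, Module.finrank_fin_fun, ← h1, add_comm, hk]
    rfl
  refine ⟨(LinearEquiv.ofInjectiveOfFinrankEq D.toLinearMap hinj hdim).toContinuousLinearEquiv, ?_⟩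
  exact hΨ.hasMFDerivAt

end MultiFlow

/-! ### Local transitivity -/

/-- If the initial velocities of `σ¹, …, σᵏ` at `y` form a basis of the tangent space of the source
fibre, then for all families `τ¹, …, τᵏ` close to `σ¹, …, σᵏ` near `y` the products
`τ¹_{t₁} ⋆ ⋯ ⋆ τᵏ_{tₖ}` pass through all arrows in a fixed neighbourhood of `1_y`. -/
theorem exists_nhds_one_eventually_multiFlow
    [FiniteDimensional ℝ E] [FiniteDimensional ℝ F]
    [IsManifold 𝓘(ℝ, E) 1 G] [IsManifold 𝓘(ℝ, F) 1 M] (hr : 1 ≤ r)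
    {y : M} {k : ℕ} (hk : k = 𝒢.fiberDim y) {σ : Fin k → ℝ → Bisection 𝒢}
    (hσ : ∀ j, SmoothFamily (σ j)) (h0 : ∀ j, σ j 0 = 1)
    (hind : LinearIndependent ℝ fun j => velocity (σ j) y)
    {U : Set M} (hU : IsOpen U) (hy : y ∈ U) {l : Filter (Fin k → ℝ → Bisection 𝒢)}
    (hl : ∀ j, ∀ p : ℝ × M, p.2 ∈ U →
      Tendsto (fun q : (Fin k → ℝ → Bisection 𝒢) × (ℝ × M) => q.1 j q.2.1 q.2.2) (l ×ˢ 𝓝 p)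
        (𝓝 (σ j p.1 p.2))) :
    ∃ 𝒪 ∈ 𝓝 (𝒢.one y), ∀ᶠ τ in l, (∀ j, SmoothFamily (τ j)) →
      ∀ g ∈ 𝒪, ∃ t, ‖t‖ ≤ 1 ∧ multiFlow τ t (𝒢.src g) = g := by
  obtain ⟨L, hL⟩ := exists_hasMFDerivAt_multiFlow hr hk hσ h0 hind
  let I := 𝓘(ℝ, Fin k → ℝ).prod 𝓘(ℝ, F)
  let p₀ : (Fin k → ℝ) × M := (0, y)
  let Ψ : (Fin k → ℝ → Bisection 𝒢) → (Fin k → ℝ) × M → G := fun τ p => multiFlow τ p.1 p.2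
  let c := extChartAt I p₀
  have hΨσ : Continuous (Ψ σ) := (smoothFamily_multiFlow hσ).continuous
  have hΨ0 : Ψ σ p₀ = 𝒢.one y := by
    simp only [Ψ, p₀, multiFlow_zero h0, Bisection.one_apply]
  let φ := extChartAt 𝓘(ℝ, E) (Ψ σ p₀)
  let H : (Fin k → ℝ → Bisection 𝒢) → (Fin k → ℝ) × F → E := fun τ q => φ (Ψ τ (c.symm q))
  have hH : HasFDerivAt (H σ) (L : ((Fin k → ℝ) × F) →L[ℝ] E) (c p₀) := by
    have h1 : HasFDerivWithinAt (H σ) (L : ((Fin k → ℝ) × F) →L[ℝ] E) univ (c p₀) := by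
      rw [← ModelWithCorners.range_eq_univ I]
      exact hL.2
    exact hasFDerivWithinAt_univ.1 h1
  have hHp₀ : H σ (c p₀) = φ (Ψ σ p₀) := by
    simp only [H, c, extChartAt_to_inv]
  have hct : IsOpen c.target := isOpen_extChartAt_target p₀
  have hcs : ContinuousOn c.symm c.target := continuousOn_extChartAt_symm p₀
  have hφs : IsOpen φ.source := isOpen_extChartAt_source _
  have hcp₀ : c.symm (c p₀) = p₀ := extChartAt_to_inv p₀
  have hcat : ContinuousAt c.symm (c p₀) := continuousAt_extChartAt_symm p₀
  -- The bound on `t` is kept so that the covering parameters stay in a compact set, the only place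
  -- where families close to `ι_M` are controlled uniformly.
  have hs : ∀ᶠ q in 𝓝 (c p₀), q ∈ c.target ∧ Ψ σ (c.symm q) ∈ φ.source ∧ ‖(c.symm q).1‖ ≤ 1 ∧
      Tendsto (fun u : (Fin k → ℝ → Bisection 𝒢) × ((Fin k → ℝ) × M) => Ψ u.1 u.2)
        (l ×ˢ 𝓝 (c.symm q)) (𝓝 (Ψ σ (c.symm q))) := by
    have h2 : ∀ᶠ p in 𝓝 p₀, Ψ σ p ∈ φ.source ∧ ‖p.1‖ ≤ 1 ∧
      Tendsto (fun u : (Fin k → ℝ → Bisection 𝒢) × ((Fin k → ℝ) × M) => Ψ u.1 u.2)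
        (l ×ˢ 𝓝 p) (𝓝 (Ψ σ p)) := by
      refine (hΨσ.continuousAt.eventually_mem (hφs.mem_nhds (mem_extChartAt_source _))).and
        (Eventually.and ?_ (eventually_tendsto_listProd hU hy hσ h0 hl _))
      have h3 : Tendsto (fun p : (Fin k → ℝ) × M => ‖p.1‖) (𝓝 p₀) (𝓝 ‖p₀.1‖) :=
        continuous_fst.norm.tendsto _
      exact h3.eventually (ge_mem_nhds (by simp [p₀]))
    rw [← hcp₀] at h2
    have h4 : ∀ᶠ q in 𝓝 (c p₀), q ∈ c.target := hct.mem_nhds (mem_extChartAt_target p₀)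
    exact h4.and (hcat.eventually h2)
  obtain ⟨K, hKs, hK, ε, hε, 𝒪, h𝒪, hcov⟩ := hH.exists_nhds_subset_image_of_close hs
  refine ⟨φ.source ∩ φ ⁻¹' 𝒪, ?_, ?_⟩
  · rw [hHp₀] at h𝒪
    rw [← hΨ0]
    exact inter_mem (hφs.mem_nhds (mem_extChartAt_source _))
      ((continuousAt_extChartAt (Ψ σ p₀)).preimage_mem_nhds h𝒪)
  -- Continuous convergence at each point of the compact set `K` is uniform convergence on `K`.
  have hclose : ∀ᶠ τ in l, ∀ q ∈ K, Ψ τ (c.symm q) ∈ φ.source ∧ ‖H τ q - H σ q‖ ≤ ε := by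
    have h1 : {u : (Fin k → ℝ → Bisection 𝒢) × ((Fin k → ℝ) × F) |
        Ψ u.1 (c.symm u.2) ∈ φ.source ∧ ‖H u.1 u.2 - H σ u.2‖ ≤ ε} ∈ l ×ˢ 𝓝ˢ K := by
      refine hK.mem_prod_nhdsSet_of_forall fun q hq => ?_
      obtain ⟨hqt, hqs, -, hqc⟩ := hKs hq
      have h2 : Tendsto c.symm (𝓝 q) (𝓝 (c.symm q)) := (hcs.continuousAt (hct.mem_nhds hqt)).tendsto
      have h3 : Tendsto (fun u : (Fin k → ℝ → Bisection 𝒢) × ((Fin k → ℝ) × F) =>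
          Ψ u.1 (c.symm u.2)) (l ×ˢ 𝓝 q) (𝓝 (Ψ σ (c.symm q))) :=
        hqc.comp (tendsto_id.prodMap h2)
      have hφq : Tendsto φ (𝓝 (Ψ σ (c.symm q))) (𝓝 (H σ q)) :=
        ((continuousOn_extChartAt (Ψ σ p₀)).continuousAt (hφs.mem_nhds hqs)).tendsto
      have h4 : Tendsto (fun u : (Fin k → ℝ → Bisection 𝒢) × ((Fin k → ℝ) × F) => H u.1 u.2)
          (l ×ˢ 𝓝 q) (𝓝 (H σ q)) := hφq.comp h3
      have h5 : Tendsto (fun u : (Fin k → ℝ → Bisection 𝒢) × ((Fin k → ℝ) × F) => H σ u.2)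
          (l ×ˢ 𝓝 q) (𝓝 (H σ q)) :=
        hφq.comp (((hΨσ.tendsto _).comp h2).comp tendsto_snd)
      have h6 := (h4.sub h5).norm
      rw [sub_self, norm_zero] at h6
      exact (h3.eventually (hφs.mem_nhds hqs)).and (h6.eventually (ge_mem_nhds hε))
    obtain ⟨S, hS, T, hT, hST⟩ := mem_prod_iff.1 h1
    filter_upwards [hS] with τ hτ q hq
    exact hST (show (τ, q) ∈ S ×ˢ T from ⟨hτ, subset_of_mem_nhdsSet hT hq⟩)
  filter_upwards [hclose] with τ hτ hsmooth g hg
  have hΨτ : ContMDiff I 𝓘(ℝ, E) 1 (Ψ τ) := (smoothFamily_multiFlow hsmooth).of_le hr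
  have hO : IsOpen (c.target ∩ (fun q => Ψ τ (c.symm q)) ⁻¹' φ.source) :=
    (hΨτ.continuous.comp_continuousOn hcs).isOpen_inter_preimage hct hφs
  have hsub : 𝒪 ⊆ H τ '' K := by
    refine hcov (H τ) _ hO (fun q hq => ⟨(hKs hq).1, (hτ q hq).1⟩) ?_ fun q hq => (hτ q hq).2
    have h1 : ContMDiffOn 𝓘(ℝ, (Fin k → ℝ) × F) 𝓘(ℝ, E) 1 (H τ)
        (c.target ∩ (fun q => Ψ τ (c.symm q)) ⁻¹' φ.source) := by
      have h2 : ContMDiffOn 𝓘(ℝ, (Fin k → ℝ) × F) I 1 c.symm c.target :=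
        contMDiffOn_extChartAt_symm (n := 1) (I := I) p₀
      have h3 : ContMDiffOn 𝓘(ℝ, E) 𝓘(ℝ, E) 1 φ φ.source := by
        have := contMDiffOn_extChartAt (n := 1) (I := 𝓘(ℝ, E)) (x := Ψ σ p₀)
        rwa [← extChartAt_source 𝓘(ℝ, E)] at this
      exact h3.comp (hΨτ.comp_contMDiffOn (h2.mono inter_subset_left)) fun q hq => hq.2
    exact h1.contDiffOn
  obtain ⟨q, hq, hqg⟩ := hsub hg.2
  have h1 : Ψ τ (c.symm q) = g := φ.injOn (hτ q hq).1 hg.1 hqg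
  refine ⟨(c.symm q).1, (hKs hq).2.2.1, ?_⟩
  rw [← h1, Bisection.src_apply]

/-! ### From local transitivity to transitivity -/

/-- A system of filters on the bisections, compatible with products, which is locally transitive
along a leaf is transitive on the component of the source fibre. -/
theorem exists_frequently_apply_eq {ι : Type*} (c : ι → Filter (Bisection 𝒢))
    (hc : ∀ i j, ∃ k, Tendsto (fun q : Bisection 𝒢 × Bisection 𝒢 => q.1 * q.2) (c i ×ˢ c j) (c k))
    {x : M} (hloc : ∀ y ∈ 𝒢.leaf x, ∃ i, ∃ 𝒪 ∈ 𝓝 (𝒢.one y), ∀ g ∈ 𝒪, ∃ᶠ σ in c i, σ (𝒢.src g) = g)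
    {γ : G} (hγ : γ ∈ 𝒢.fiberComponent x) : ∃ i, ∃ᶠ σ in c i, σ x = γ := by
  have hfib : ∀ g ∈ 𝒢.fiberComponent x, 𝒢.src g = x := fun g hg =>
    connectedComponentIn_subset (𝒢.src ⁻¹' {x}) (𝒢.one x) hg
  -- A chain of small steps inside the fibre: `(g₃.g₂⁻¹).(g₂.g₁⁻¹) = g₃.g₁⁻¹` makes the relation
  -- transitive, with products of bisections matching products of filters.
  let P : G → G → Prop := fun g h => ∃ i, ∃ᶠ σ in c i, σ (𝒢.tgt g) = 𝒢.mul h (𝒢.inv g)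
  have hone : 𝒢.one x ∈ 𝒢.fiberComponent x := mem_connectedComponentIn (𝒢.src_one x)
  have hP : P (𝒢.one x) γ := by
    refine (isPreconnected_connectedComponentIn : IsPreconnected (𝒢.fiberComponent x)).induction₂'
      P ?_ ?_ hone hγ
    · intro g hg
      obtain ⟨i, 𝒪, h𝒪, hO⟩ := hloc (𝒢.tgt g) ⟨g, hg, rfl⟩
      rw [← 𝒢.mul_inv] at h𝒪
      have hid : Tendsto (fun h : 𝒢.fiberComponent x => (h : G)) (𝓝 ⟨g, hg⟩) (𝓝 g) :=
        continuous_subtype_val.tendsto _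
      have hcomp : ∀ h₁ h₂ : 𝒢.fiberComponent x, 𝒢.src (h₁ : G) = 𝒢.tgt (𝒢.inv h₂) := by
        intro h₁ h₂
        rw [𝒢.tgt_inv, hfib _ h₁.2, hfib _ h₂.2]
      have hgg : 𝒢.src g = 𝒢.tgt (𝒢.inv g) := (𝒢.tgt_inv g).symm
      have h1 : Tendsto (fun h : 𝒢.fiberComponent x => 𝒢.mul h (𝒢.inv g)) (𝓝 ⟨g, hg⟩)
          (𝓝 (𝒢.mul g (𝒢.inv g))) :=
        tendsto_mul (fun h => hcomp h ⟨g, hg⟩) hgg hid tendsto_const_nhds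
      have h2 : Tendsto (fun h : 𝒢.fiberComponent x => 𝒢.mul g (𝒢.inv h)) (𝓝 ⟨g, hg⟩)
          (𝓝 (𝒢.mul g (𝒢.inv g))) :=
        tendsto_mul (fun h => hcomp ⟨g, hg⟩ h) hgg tendsto_const_nhds
          ((continuous_inv.tendsto g).comp hid)
      rw [nhdsWithin_eq_map_subtype_coe hg, eventually_map]
      filter_upwards [h1.eventually h𝒪, h2.eventually h𝒪] with h hh1 hh2
      refine ⟨⟨i, ?_⟩, ⟨i, ?_⟩⟩
      · have := hO _ hh1
        rwa [𝒢.src_mul _ _ (hcomp h ⟨g, hg⟩), 𝒢.src_inv] at this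
      · have := hO _ hh2
        rwa [𝒢.src_mul _ _ (hcomp ⟨g, hg⟩ h), 𝒢.src_inv] at this
    · rintro g₁ g₂ g₃ hg₁ hg₂ hg₃ ⟨i, hi⟩ ⟨j, hj⟩
      obtain ⟨k, hk⟩ := hc j i
      have h12 : 𝒢.src g₂ = 𝒢.tgt (𝒢.inv g₁) := by rw [𝒢.tgt_inv, hfib _ hg₁, hfib _ hg₂]
      have h23 : 𝒢.src g₃ = 𝒢.tgt (𝒢.inv g₂) := by rw [𝒢.tgt_inv, hfib _ hg₂, hfib _ hg₃]
      refine ⟨k, hk.frequently ((frequently_prod_and.2 ⟨hj, hi⟩).mono ?_)⟩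
      rintro ⟨τ, σ⟩ ⟨hτ, hσ⟩
      have hs : 𝒢.src (𝒢.inv g₂) = 𝒢.tgt (𝒢.mul g₂ (𝒢.inv g₁)) := by
        rw [𝒢.src_inv, 𝒢.tgt_mul _ _ h12]
      simp only [Bisection.mul_apply]
      rw [hσ, 𝒢.tgt_mul _ _ h12, hτ, 𝒢.mul_assoc _ _ _ h23 hs,
        ← 𝒢.mul_assoc _ _ _ (𝒢.src_inv g₂) h12, 𝒢.inv_mul, hfib _ hg₂, ← hfib _ hg₁,
        ← 𝒢.tgt_inv, 𝒢.one_mul]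
  obtain ⟨i, hi⟩ := hP
  refine ⟨i, hi.mono fun σ hσ => ?_⟩
  rwa [𝒢.tgt_one, inv_one, ← hfib γ hγ, 𝒢.mul_one, hfib γ hγ] at hσ

variable {Γ : Subgroup (Bisection 𝒢)}

/-! ### Small isotopies -/

/-- Condition (L) asks for closeness to `ι_M` at all times. Reparametrizing by `ε sin t` confines
time to `[-ε, ε]`, stays analytic (cutoffs would not), and only rescales the initial velocity by
`ε`. -/
theorem comp_sin_mem_isotopies {σ : ℝ → Bisection 𝒢} (hσ : σ ∈ isotopies Γ) (ε : ℝ) :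
    (fun t => σ (ε * Real.sin t)) ∈ isotopies Γ :=
  ⟨SmoothFamily.comp hσ.1 (contDiff_const.mul Real.contDiff_sin), fun _ => hσ.2.1 _, by
    simpa using hσ.2.2⟩

theorem velocity_comp_sin (hr : 1 ≤ r) {σ : ℝ → Bisection 𝒢} (hσ : σ ∈ isotopies Γ) (ε : ℝ) (x : M) :
    velocity (fun t => σ (ε * Real.sin t)) x = ε • velocity σ x := by
  have h1 : ContMDiff 𝓘(ℝ, ℝ) 𝓘(ℝ, E) r fun t : ℝ => σ t x :=
    ContMDiff.comp (g := fun p : ℝ × M => σ p.1 p.2) hσ.1 (contMDiff_id.prodMk contMDiff_const)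
  have h2 := (h1.mdifferentiable (zero_lt_one.trans_le hr).ne' (ε * Real.sin 0)).hasMFDerivAt
  have h3 : HasFDerivAt (fun t : ℝ => ε * Real.sin t)
      (ContinuousLinearMap.toSpanSingleton ℝ (ε * Real.cos 0)) 0 :=
    ((Real.hasDerivAt_sin 0).const_mul ε).hasFDerivAt
  have h4 := (h2.comp (0 : ℝ) h3.hasMFDerivAt).mfderiv
  have h5 := congrArg (fun T : ℝ →L[ℝ] E => T 1) h4
  refine Eq.trans h5 ?_
  have h6 : ε * Real.sin 0 = 0 := by simp
  rw [h6]
  let D : ℝ →L[ℝ] E := mfderiv 𝓘(ℝ, ℝ) 𝓘(ℝ, E) (fun t : ℝ => σ t x) 0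
  have h7 : D ((1 : ℝ) • (ε * Real.cos 0)) = ε • D 1 := by
    rw [← map_smul]; simp
  exact h7

theorem exists_comp_sin_mem [IsManifold 𝓘(ℝ, E) 1 G] [IsManifold 𝓘(ℝ, F) 1 M] (hr : 1 ≤ r)
    {σ : ℝ → Bisection 𝒢} (hσ : σ ∈ isotopies Γ) {𝒩 : Set (M → G)}
    (h𝒩 : 𝒩 ∈ nhdsC1On F E univ 𝒢.one) : ∃ ε > 0, ∀ t, ⇑(σ (ε * Real.sin t)) ∈ 𝒩 := by
  have h1 := ContMDiff.tendsto_nhdsC1On_family (f := fun t => ⇑(σ t)) (hσ.1.of_le hr) univ 0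
  have h2 : ⇑(σ 0) = 𝒢.one := by rw [hσ.2.2]; rfl
  rw [h2] at h1
  obtain ⟨ε, hε, hball⟩ := Metric.nhds_basis_closedBall.eventually_iff.1 (h1.eventually h𝒩)
  refine ⟨ε, hε, fun t => hball ?_⟩
  rw [mem_closedBall_zero_iff, Real.norm_eq_abs, abs_mul, abs_of_pos hε]
  exact mul_le_of_le_one_right hε.le (Real.abs_sin_le_one t)

theorem FiberwiseTransitive.exists_small [IsManifold 𝓘(ℝ, E) 1 G] [IsManifold 𝓘(ℝ, F) 1 M]
    (hT : FiberwiseTransitive Γ) (hr : 1 ≤ r) (y : M) {𝒩 : Set (M → G)}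
    (h𝒩 : 𝒩 ∈ nhdsC1On F E univ 𝒢.one) :
    ∃ σ : Fin (𝒢.fiberDim y) → ℝ → Bisection 𝒢, (∀ j, σ j ∈ isotopies Γ) ∧
      (∀ j t, ⇑(σ j t) ∈ 𝒩) ∧ LinearIndependent ℝ fun j => velocity (σ j) y := by
  obtain ⟨σ, hσ, hind⟩ := hT y
  choose ε hε hεmem using fun j => exists_comp_sin_mem hr (hσ j) h𝒩
  refine ⟨fun j t => σ j (ε j * Real.sin t), fun j => comp_sin_mem_isotopies (hσ j) _, hεmem, ?_⟩
  simp only [velocity_comp_sin hr (hσ _)]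
  exact hind.units_smul fun j => Units.mk0 (ε j) (hε j).ne'

/-! ### Transitivity with controlled support -/

/-- The case of the constant approximation: the filter is `pure σ`, so no closeness is at stake. -/
theorem exists_nhds_one_multiFlow [FiniteDimensional ℝ E] [FiniteDimensional ℝ F]
    [IsManifold 𝓘(ℝ, E) 1 G] [IsManifold 𝓘(ℝ, F) 1 M] (hr : 1 ≤ r) {y : M}
    {σ : Fin (𝒢.fiberDim y) → ℝ → Bisection 𝒢} (hσ : ∀ j, σ j ∈ isotopies Γ)
    (hind : LinearIndependent ℝ fun j => velocity (σ j) y) :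
    ∃ 𝒪 ∈ 𝓝 (𝒢.one y), ∀ g ∈ 𝒪, ∃ t, multiFlow σ t (𝒢.src g) = g := by
  obtain ⟨𝒪, h𝒪, h⟩ := exists_nhds_one_eventually_multiFlow hr rfl (fun j => (hσ j).1)
    (fun j => (hσ j).2.2) hind isOpen_univ (mem_univ y) (l := pure σ) fun j p _ => by
      rw [pure_prod, tendsto_map'_iff]
      exact (hσ j).1.continuous.tendsto p
  rw [eventually_pure] at h
  exact ⟨𝒪, h𝒪, fun g hg => (h (fun j => (hσ j).1) g hg).imp fun _ ht => ht.2⟩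

/-- A subgroup which is locally transitive along a leaf is transitive on the component of
the source fibre. -/
theorem exists_mem_apply_eq {x : M} (hloc : ∀ y ∈ 𝒢.leaf x, ∃ 𝒪 ∈ 𝓝 (𝒢.one y), ∀ g ∈ 𝒪,
      ∃ σ ∈ Γ, σ (𝒢.src g) = g) {γ : G} (hγ : γ ∈ 𝒢.fiberComponent x) : ∃ σ ∈ Γ, σ x = γ := by
  obtain ⟨-, h⟩ := exists_frequently_apply_eq (fun _ : Unit => 𝓟 (Γ : Set (Bisection 𝒢)))
    (fun _ _ => ⟨(), by
      rw [prod_principal_principal, tendsto_principal_principal]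
      exact fun q hq => Γ.mul_mem hq.1 hq.2⟩)
    (fun y hy => ⟨(), by simpa only [frequently_principal] using! hloc y hy⟩) hγ
  simpa only [frequently_principal] using! h

theorem Bisection.baseSupp_subset_supp (σ : Bisection 𝒢) : σ.baseSupp ⊆ σ.supp :=
  closure_mono fun x hx h => hx (by rw [h, 𝒢.tgt_one])

theorem Bisection.inv_apply_of_apply_eq_one {σ : Bisection 𝒢} {x : M} (h : σ x = 𝒢.one x) :
    σ⁻¹ x = 𝒢.one x := by
  have h1 : σ.base.symm x = x := by
    have h2 := σ.tgt_apply x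
    rw [h, 𝒢.tgt_one] at h2
    conv_lhs => rw [h2]
    exact σ.base.symm_apply_apply x
  rw [Bisection.inv_apply, h1, h, inv_one]

/-- The subgroup of the elements of `Γ` supported in `V`. -/
def supportedIn (Γ : Subgroup (Bisection 𝒢)) (V : Set M) : Subgroup (Bisection 𝒢) where
  carrier := {σ | σ ∈ Γ ∧ σ.supp ⊆ V}
  one_mem' := ⟨Γ.one_mem, by simp [Bisection.supp, Bisection.one_apply]⟩
  mul_mem' := by
    rintro σ τ ⟨hσ, hσV⟩ ⟨hτ, hτV⟩
    refine ⟨Γ.mul_mem hσ hτ, ?_⟩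
    have h1 : {x | (σ * τ) x ≠ 𝒢.one x} ⊆ {x | σ x ≠ 𝒢.one x} ∪ {x | τ x ≠ 𝒢.one x} := by
      intro x hx
      by_contra hcon
      simp only [mem_union, mem_ofPred_eq, not_or, not_not] at hcon
      refine hx ?_
      have h2 := 𝒢.one_mul (𝒢.one x)
      rw [𝒢.tgt_one] at h2
      rw [Bisection.mul_apply, hcon.2, 𝒢.tgt_one, hcon.1, h2]
    refine (closure_mono h1).trans ?_
    rw [closure_union]
    exact union_subset hσV hτV
  inv_mem' := by
    rintro σ ⟨hσ, hσV⟩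
    have h1 : {x | σ⁻¹ x ≠ 𝒢.one x} ⊆ {x | σ x ≠ 𝒢.one x} := fun x hx h =>
      hx (Bisection.inv_apply_of_apply_eq_one h)
    exact ⟨Γ.inv_mem hσ, (closure_mono h1).trans hσV⟩

/-- Supplies the pair of sets for (L). The closure of the larger one is kept inside `V` because it
serves as the compact exceptional set when `r = ω`. -/
theorem exists_isOpen_closure_chain {X : Type*} [TopologicalSpace X] [T2Space X]
    [LocallyCompactSpace X] {V : Set X} (hV : IsOpen V) {y : X} (hy : y ∈ V) :
    ∃ U V' : Set X, y ∈ U ∧ IsOpen U ∧ IsCompact (closure U) ∧ IsOpen V' ∧ IsCompact (closure V') ∧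
      closure U ⊆ V' ∧ closure V' ⊆ V := by
  obtain ⟨V', hV', hyV', hV'V, hcV'⟩ := exists_open_between_and_isCompact_closure
    (isCompact_singleton (x := y)) hV (singleton_subset_iff.2 hy)
  obtain ⟨U, hU, hyU, hUV', hcU⟩ := exists_open_between_and_isCompact_closure
    (isCompact_singleton (x := y)) hV' hyV'
  exact ⟨U, V', singleton_subset_iff.1 hyU, hU, hcU, hV', hcV', hUV', hV'V⟩

section Locality

variable [FiniteDimensional ℝ E] [FiniteDimensional ℝ F] [T2Space M]
  [IsManifold 𝓘(ℝ, E) 1 G] [IsManifold 𝓘(ℝ, F) 1 M]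

theorem SmoothLCondition.exists_nhds_one (hL : SmoothLCondition Γ) (hT : FiberwiseTransitive Γ)
    (hr : 1 ≤ r) {V : Set M} (hV : IsOpen V) {y : M} (hy : y ∈ V) :
    ∃ 𝒪 ∈ 𝓝 (𝒢.one y), ∀ g ∈ 𝒪, ∃ σ ∈ supportedIn Γ V, σ (𝒢.src g) = g := by
  have : LocallyCompactSpace M := ChartedSpace.locallyCompactSpace F M
  obtain ⟨U, V', hyU, hU, hcU, hV', hcV', hUV', hV'V⟩ := exists_isOpen_closure_chain hV hy
  obtain ⟨𝒩, h𝒩, h⟩ := hL U V' hU hcU hV' hcV' hUV'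
  obtain ⟨σ, hσ, hσ𝒩, hind⟩ := hT.exists_small hr y h𝒩
  choose τ hτ hτσ using fun j => h (σ j) (hσ j) (hσ𝒩 j)
  -- The localized isotopies agree with the original ones at `y ∈ U` for all `t`.
  have hvel : ∀ j, velocity (τ j) y = velocity (σ j) y := by
    intro j
    have h1 : (fun t => τ j t y) = fun t => σ j t y := funext fun t => (hτσ j t).1 hyU
    exact congrArg (fun f : ℝ → G => (mfderiv 𝓘(ℝ, ℝ) 𝓘(ℝ, E) f 0 : ℝ → E) 1) h1
  obtain ⟨𝒪, h𝒪, h𝒪τ⟩ := exists_nhds_one_multiFlow hr hτ (by simpa only [hvel] using hind)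
  refine ⟨𝒪, h𝒪, fun g hg => ?_⟩
  obtain ⟨t, ht⟩ := h𝒪τ g hg
  exact ⟨_, multiFlow_mem (Γ := supportedIn Γ V) (fun j s => ⟨(hτ j).2.1 s,
    (hτσ j s).2.trans (subset_closure.trans hV'V)⟩) t, ht⟩

/-! ### Transitivity with approximately controlled support -/

omit [FiniteDimensional ℝ E] [FiniteDimensional ℝ F] [T2Space M] [IsManifold 𝓘(ℝ, E) 1 G]
  [IsManifold 𝓘(ℝ, F) 1 M] in
theorem mdifferentiable_tgt_comp (hr : 1 ≤ r) (σ : Bisection 𝒢) :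
    MDifferentiable 𝓘(ℝ, F) 𝓘(ℝ, F) fun x => 𝒢.tgt (σ x) :=
  (contMDiff_tgt.comp σ.contMDiff).mdifferentiable (zero_lt_one.trans_le hr).ne'

omit [FiniteDimensional ℝ E] [FiniteDimensional ℝ F] [T2Space M] [IsManifold 𝓘(ℝ, E) 1 G]
  [IsManifold 𝓘(ℝ, F) 1 M] in
theorem tgt_comp_mul (σ τ : Bisection 𝒢) : (fun x => 𝒢.tgt ((σ * τ) x)) =
    (fun x => 𝒢.tgt (σ x)) ∘ fun x => 𝒢.tgt (τ x) :=
  funext fun _ => 𝒢.tgt_mul _ _ (σ.src_apply _)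

/-- The filter of the elements `σ` of `Γ` for which `β ∘ σ` is `C¹` close to the identity outside
`K`. -/
def nearIdOff (Γ : Subgroup (Bisection 𝒢)) (K : Set M) : Filter (Bisection 𝒢) :=
  comap (fun σ x => 𝒢.tgt (σ x)) (nhdsC1On F F Kᶜ (id : M → M)) ⊓ 𝓟 (Γ : Set (Bisection 𝒢))

omit [FiniteDimensional ℝ E] [FiniteDimensional ℝ F] [T2Space M] [IsManifold 𝓘(ℝ, E) 1 G] in
theorem tendsto_nearIdOff_iff {ι : Type*} {l : Filter ι} {K : Set M} {f : ι → Bisection 𝒢} :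
    Tendsto f l (nearIdOff Γ K) ↔
      Tendsto (fun i x => 𝒢.tgt (f i x)) l (nhdsC1On F F Kᶜ (id : M → M)) ∧ ∀ᶠ i in l, f i ∈ Γ := by
  rw [nearIdOff, tendsto_inf, tendsto_comap_iff, tendsto_principal]
  rfl

-- The reason for compact exceptional sets: the complement of `K ∪ K'` is open, so a map close to
-- the identity carries compact subsets of it to where the next map is still controlled. This could
-- fail on the closed set `Vᶜ`.
omit [FiniteDimensional ℝ E] [IsManifold 𝓘(ℝ, E) 1 G] in
theorem tendsto_mul_nearIdOff (hr : 1 ≤ r) {K K' : Set M} (hK : IsCompact K) (hK' : IsCompact K') :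
    Tendsto (fun q : Bisection 𝒢 × Bisection 𝒢 => q.1 * q.2)
      (nearIdOff Γ K ×ˢ nearIdOff Γ K') (nearIdOff Γ (K ∪ K')) := by
  have h1 := tendsto_nearIdOff_iff.1
    (tendsto_fst : Tendsto Prod.fst (nearIdOff Γ K ×ˢ nearIdOff Γ K') (nearIdOff Γ K))
  have h2 := tendsto_nearIdOff_iff.1
    (tendsto_snd : Tendsto Prod.snd (nearIdOff Γ K ×ˢ nearIdOff Γ K') (nearIdOff Γ K'))
  refine tendsto_nearIdOff_iff.2 ⟨?_, ?_⟩
  · rw [show (fun (q : Bisection 𝒢 × Bisection 𝒢) x => 𝒢.tgt ((q.1 * q.2) x)) = fun q => _ from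
      funext fun q => tgt_comp_mul q.1 q.2]
    exact tendsto_comp_nhdsC1On_id (hK.union hK').isClosed.isOpen_compl
      (fun q => mdifferentiable_tgt_comp hr q.1) (fun q => mdifferentiable_tgt_comp hr q.2)
      (h1.1.mono_right (nhdsC1On_anti (compl_subset_compl.2 subset_union_left) _))
      (h2.1.mono_right (nhdsC1On_anti (compl_subset_compl.2 subset_union_right) _))
  · filter_upwards [h1.2, h2.2] with q hq1 hq2 using Γ.mul_mem hq1 hq2

omit [FiniteDimensional ℝ E] [T2Space M] in
/-- If the families `τ¹, …, τᵏ` in `Γ` tend to the constant family `ι_M` outside `A`, then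
their products tend to the identity outside every closed set `K ⊇ A`, uniformly for bounded times. -/
theorem tendsto_multiFlow_nearIdOff (hr : 1 ≤ r) {k : ℕ} {n : Filter (Fin k → ℝ → Bisection 𝒢)}
    {A K : Set M} (hK : IsClosed K) (hAK : A ⊆ K)
    (hn : ∀ j, Tendsto (fun (τ : Fin k → ℝ → Bisection 𝒢) t => ⇑(τ j t)) n
      (nhdsC1FamilyOn F E Aᶜ fun _ => 𝒢.one))
    (hnΓ : ∀ᶠ τ in n, ∀ j, τ j ∈ isotopies Γ) :
    Tendsto (fun q : (Fin k → ℝ → Bisection 𝒢) × (Fin k → ℝ) => multiFlow q.1 q.2)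
      (n ×ˢ 𝓟 (Metric.closedBall 0 1)) (nearIdOff Γ K) := by
  have hr0 : r ≠ 0 := (zero_lt_one.trans_le hr).ne'
  have hone : 𝒢.tgt ∘ 𝒢.one = id := funext 𝒢.tgt_one
  have hfactor : ∀ j, Tendsto
      (fun (q : (Fin k → ℝ → Bisection 𝒢) × (Fin k → ℝ)) x => 𝒢.tgt (q.1 j (q.2 j) x))
      (n ×ˢ 𝓟 (Metric.closedBall 0 1)) (nhdsC1On F F Kᶜ (id : M → M)) := by
    intro j
    have h1 := (hn j).comp_nhdsC1FamilyOn_const (b := 𝒢.tgt) (contMDiff_tgt.of_le hr)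
      (𝒢.contMDiff_one.mdifferentiable hr0) (fun τ t => (τ j t).contMDiff.mdifferentiable hr0)
      (isCompact_Icc (a := (-1 : ℝ)) (b := 1))
    rw [hone] at h1
    have h2 : Tendsto (fun q : (Fin k → ℝ → Bisection 𝒢) × (Fin k → ℝ) => (q.1, q.2 j))
        (n ×ˢ 𝓟 (Metric.closedBall 0 1)) (n ×ˢ 𝓟 (Icc (-1 : ℝ) 1)) := by
      refine Tendsto.prodMap (f := id) (g := fun t : Fin k → ℝ => t j) tendsto_id
        (tendsto_principal_principal.2 fun t ht => ?_)
      exact abs_le.1 ((norm_le_pi_norm t j).trans (mem_closedBall_zero_iff.1 ht))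
    exact (h1.comp h2).mono_right (nhdsC1On_anti (compl_subset_compl.2 hAK) _)
  refine tendsto_nearIdOff_iff.2 ⟨?_, ?_⟩
  · unfold multiFlow
    generalize List.finRange k = L
    induction L with
    | nil =>
      simp only [List.map_nil, List.prod_nil, Bisection.one_apply, 𝒢.tgt_one]
      exact tendsto_nhdsC1On_iff.2 fun _ _ _ _ _ h => Eventually.of_forall fun _ => h
    | cons j L ih =>
      simp only [List.map_cons, List.prod_cons]
      rw [show (fun (q : (Fin k → ℝ → Bisection 𝒢) × (Fin k → ℝ)) x =>
        𝒢.tgt ((q.1 j (q.2 j) * (L.map fun j => q.1 j (q.2 j)).prod) x)) = fun q => _ from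
          funext fun q => tgt_comp_mul _ _]
      exact tendsto_comp_nhdsC1On_id hK.isOpen_compl (fun q => mdifferentiable_tgt_comp hr _)
        (fun q => mdifferentiable_tgt_comp hr _) (hfactor j) ih
  · filter_upwards [tendsto_fst.eventually hnΓ] with q hq
    exact multiFlow_mem (fun j s => (hq j).2.1 s) _

theorem AnalyticLCondition.exists_nhds_one (hL : AnalyticLCondition Γ)
    (hT : FiberwiseTransitive Γ) (hr : 1 ≤ r) {V : Set M} (hV : IsOpen V) {y : M} (hy : y ∈ V) :
    ∃ K, (IsCompact K ∧ K ⊆ V) ∧ ∃ 𝒪 ∈ 𝓝 (𝒢.one y), ∀ g ∈ 𝒪,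
      ∃ᶠ σ in nearIdOff Γ K, σ (𝒢.src g) = g := by
  have : LocallyCompactSpace M := ChartedSpace.locallyCompactSpace F M
  obtain ⟨U, V', hyU, hU, hcU, hV', hcV', hUV', hV'V⟩ := exists_isOpen_closure_chain hV hy
  obtain ⟨𝒩, h𝒩, h⟩ := hL U V' hU hcU hV' hcV' hUV'
  obtain ⟨σ, hσ, hσ𝒩, hind⟩ := hT.exists_small hr y h𝒩
  let fam : (ℝ → Bisection 𝒢) → ℝ → M → G := fun τ t => ⇑(τ t)
  -- The isotopies in `Γ` approaching `σ j` on `U` and `ι_M` off `V'`. That this filter is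
  -- nontrivial is exactly what analytic (L) asserts.
  let n : Fin (𝒢.fiberDim y) → Filter (ℝ → Bisection 𝒢) := fun j =>
    (comap fam (nhdsC1FamilyOn F E U (fam (σ j))) ⊓
      comap fam (nhdsC1FamilyOn F E V'ᶜ fun _ => 𝒢.one)) ⊓ 𝓟 (isotopies Γ)
  have hn : ∀ j, (n j).NeBot := by
    intro j
    refine inf_principal_neBot_iff.2 fun S hS => ?_
    obtain ⟨S₁, ⟨𝒰, h𝒰, h𝒰S⟩, S₂, ⟨𝒱, h𝒱, h𝒱S⟩, rfl⟩ := mem_inf_iff.1 hS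
    obtain ⟨τ, hτ, hτ𝒰, hτ𝒱⟩ := h (σ j) (hσ j) (hσ𝒩 j) 𝒰 h𝒰 𝒱 h𝒱
    exact ⟨τ, ⟨h𝒰S hτ𝒰, h𝒱S hτ𝒱⟩, hτ⟩
  have hnU : ∀ j, Tendsto (fun τ : Fin (𝒢.fiberDim y) → ℝ → Bisection 𝒢 => fam (τ j)) (Filter.pi n)
      (nhdsC1FamilyOn F E U (fam (σ j))) := fun j =>
    (tendsto_comap.mono_left (inf_le_left.trans inf_le_left)).comp (tendsto_eval_pi n j)
  have hnV : ∀ j, Tendsto (fun τ : Fin (𝒢.fiberDim y) → ℝ → Bisection 𝒢 => fam (τ j)) (Filter.pi n)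
      (nhdsC1FamilyOn F E V'ᶜ fun _ => 𝒢.one) := fun j =>
    (tendsto_comap.mono_left (inf_le_left.trans inf_le_right)).comp (tendsto_eval_pi n j)
  have hnΓ : ∀ᶠ τ in Filter.pi n, ∀ j, τ j ∈ isotopies Γ := by
    refine eventually_all.2 fun j => (tendsto_eval_pi n j).eventually ?_
    exact mem_inf_of_right (mem_principal_self _)
  obtain ⟨𝒪, h𝒪, hcov⟩ := exists_nhds_one_eventually_multiFlow hr rfl (fun j => (hσ j).1)
    (fun j => (hσ j).2.2) hind hU hyU (l := Filter.pi n) fun j p hp =>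
      (hnU j).nhdsC1FamilyOn_continuous hU (hσ j).1.continuous hp
  refine ⟨closure V', ⟨hcV', hV'V⟩, 𝒪, h𝒪, fun g hg => ?_⟩
  refine (tendsto_multiFlow_nearIdOff hr isClosed_closure subset_closure hnV hnΓ).frequently ?_
  intro hcon
  -- Were the value avoided, one family `τ` would avoid it for all `‖t‖ ≤ 1` while covering `g` with
  -- such a `t`.
  rw [eventually_prod_principal_iff] at hcon
  obtain ⟨τ, hτ, hτΓ, hτcov⟩ := (hcon.and (hnΓ.and hcov)).exists
  obtain ⟨t, ht, hteq⟩ := hτcov (fun j => (hτΓ j).1) g hg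
  exact hτ t (mem_closedBall_zero_iff.2 ht) hteq

end Locality

end LieGroupoid

end

/-! ### Transitivity of `Γ` and control of the support -/

theorem corollary1p5 {r : WithTop ℕ∞} (hr : 1 ≤ r) {E F G M : Type*}
    [NormedAddCommGroup E] [NormedSpace ℝ E] [FiniteDimensional ℝ E]
    [NormedAddCommGroup F] [NormedSpace ℝ F] [FiniteDimensional ℝ F]
    [TopologicalSpace G] [T2Space G] [ChartedSpace E G]
    [TopologicalSpace M] [T2Space M] [ChartedSpace F M]
    [IsManifold 𝓘(ℝ, E) r G] [IsManifold 𝓘(ℝ, F) r M]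
    -- the next two follow from `1 ≤ r`; they are listed since tangent bundles need them
    [IsManifold 𝓘(ℝ, E) 1 G] [IsManifold 𝓘(ℝ, F) 1 M]
    (𝒢 : LieGroupoid r E F G M) (Γ : Subgroup 𝒢.Bisection)
    (hL : LieGroupoid.LCondition Γ) (hT : LieGroupoid.FiberwiseTransitive Γ)
    (γ : G) (hγ : γ ∈ 𝒢.unitComponent) :
    (∃ σ ∈ Γ, σ (𝒢.src γ) = γ) ∧
    ∀ V : Set M, IsOpen V → 𝒢.leaf (𝒢.src γ) ⊆ V →
      (r ≠ ω → ∃ σ ∈ Γ, σ (𝒢.src γ) = γ ∧ σ.baseSupp ⊆ V) ∧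
      (r = ω → ∀ 𝒩 ∈ nhdsC1On F F Vᶜ (id : M → M),
        ∃ σ ∈ Γ, σ (𝒢.src γ) = γ ∧ (fun x => 𝒢.tgt (σ x)) ∈ 𝒩) := by
  obtain ⟨x, hx⟩ := mem_iUnion.1 hγ
  obtain rfl : 𝒢.src γ = x := connectedComponentIn_subset (𝒢.src ⁻¹' {x}) (𝒢.one x) hx
  refine ⟨LieGroupoid.exists_mem_apply_eq (fun y _ => ?_) hx, fun V hV hleaf => ⟨fun hrω => ?_,
    fun hrω 𝒩 h𝒩 => ?_⟩⟩
  · obtain ⟨σ, hσ, hind⟩ := hT y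
    obtain ⟨𝒪, h𝒪, h⟩ := LieGroupoid.exists_nhds_one_multiFlow hr hσ hind
    refine ⟨𝒪, h𝒪, fun g hg => ?_⟩
    obtain ⟨t, ht⟩ := h g hg
    exact ⟨_, LieGroupoid.multiFlow_mem (fun j s => (hσ j).2.1 s) t, ht⟩
  · obtain ⟨σ, hσ, hσγ⟩ := LieGroupoid.exists_mem_apply_eq (Γ := LieGroupoid.supportedIn Γ V)
      (fun y hy => (hL.1 hrω).exists_nhds_one hT hr hV (hleaf hy)) hx
    exact ⟨σ, hσ.1, hσγ, σ.baseSupp_subset_supp.trans hσ.2⟩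
  -- Each local step brings its own compact exceptional set in `V`; chaining takes finite unions,
  -- which remain compact in `V`.
  · obtain ⟨⟨K, hK, hKV⟩, hfreq⟩ := LieGroupoid.exists_frequently_apply_eq
      (fun K : {K : Set M // IsCompact K ∧ K ⊆ V} => LieGroupoid.nearIdOff Γ K)
      (fun K K' => ⟨⟨K ∪ K', K.2.1.union K'.2.1, union_subset K.2.2 K'.2.2⟩,
        LieGroupoid.tendsto_mul_nearIdOff hr K.2.1 K'.2.1⟩)
      (fun y hy => by
        obtain ⟨K, hK, h⟩ := (hL.2 hrω).exists_nhds_one hT hr hV (hleaf hy)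
        exact ⟨⟨K, hK⟩, h⟩) hx
    -- As `K ⊆ V`, closeness to the identity off `K` implies closeness on `Vᶜ`.
    have h1 := LieGroupoid.tendsto_nearIdOff_iff.1
      (Filter.tendsto_id : Filter.Tendsto id (LieGroupoid.nearIdOff Γ K) _)
    obtain ⟨σ, hσγ, hσΓ, hσ𝒩⟩ := (hfreq.and_eventually (h1.2.and
      (h1.1 (nhdsC1On_anti (compl_subset_compl.2 hKV) _ h𝒩)))).exists
    exact ⟨σ, hσΓ, hσγ, hσ𝒩⟩
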